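/- Setting. Let $(M,g)$ be a non-empty (pseudo-)Riemannian spin manifold of dimension $n\ge 1$, with Levi-Civita connection $\nabla$, and let $S$ be its spinor bundle, i.e. the bundle associated to the spin structure and a nonzero real or complex module of the Clifford algebra, with Clifford multiplication $\gamma$, $\gamma(X)\gamma(Y)+\gamma(Y)\gamma(X)=-2g(X,Y)$, and with the connection $\nabla$ induced by the Levi-Civita connection. Let $\gamma_{\mu_1\cdots\mu_k}=\gamma_{[\mu_1}\cdots\gamma_{\mu_k]}$. Let $C$ be a charge conjugation on $S$, i.e. a nondegenerate spin-invariant bilinear form such that $C_0=C$ and $C_1$ are each symmetric or skew symmetric, where $(C_k(\phi\otimes\psi))_{\mu_1\ldots\mu_k}=C(\phi,\gamma_{\mu_1\cdots\mu_k}\psi)$. Put $\Delta_k=1$ if $C_k$ is symmetric and $\Delta_k=-1$ otherwise. Let $$\tau_0=\begin{pmatrix}1&0\\0&1\end{pmatrix},\quad \tau_1=\begin{pmatrix}0&1\\1&0\end{pmatrix},\quad \tau_2=\begin{pmatrix}0&1\\-1&0\end{pmatrix},\quad \tau_3=\begin{pmatrix}1&0\\0&-1\end{pmatrix},$$ and define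 the signs $\varepsilon_j,\varepsilon_{ij}$ by $\tau_j^{T}=\varepsilon_j\tau_j$ and $\tau_i\tau_j=\varepsilon_{ij}\tau_j\tau_i$. Equip $S\oplus S$ with Clifford multiplication on both summands and with the bilinear form $C\otimes\tau_i$, $(C\otimes\tau_i)(\eta,\xi)=\sum_{a,b}(\tau_i)_{ab}\,C(\eta_a,\xi_b)$. For a connection $D$ on $S\oplus S$ let $D^C$ be the connection for which $D\otimes 1+1\otimes D^C$ makes $C\otimes\tau_i$ parallel, and let $(\hat D_X\gamma)(Y)\xi=D_X(\gamma(Y)\xi)-\gamma(\nabla_XY)\xi-\gamma(Y)D^C_X\xi$. The connection $D$ is called admissible if $D^C$ exists and $(\hat D_X\gamma)(Y)=-(\hat D_Y\gamma)(X)$ for all vector fields $X,Y$. Theorem. Let $i,j\in\{0,1,2,3\}$. (1) For all $k$ the map $C_k$ has the symmetry $\Delta_k$, that is, $C_k(\psi\otimes\phi)=\Delta_k\,C_k(\phi\otimes\psi)$. (2) Let $F$ be an $\ell$-form on $M$ which does not vanish identically (with values in the ground field of $S$), and let $$\mathcal A_\mu=\tfrac1{\ell!}F_{i_1\ldots i_\ell}\gamma^{i_1\ldots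 i_\ell}\gamma_\mu\otimes\tau_j .$$ Then the connection $\nabla+\mathcal A$ on $S\oplus S$ is admissible if and only if $$\Delta_\ell\,\Delta_1\,\varepsilon_j\,\varepsilon_{ij}=-1 .$$ More generally, if $D$ is any admissible connection on $S\oplus S$, then $D+\mathcal A$ is admissible if and only if this equation holds. (3) For $0\le\ell\le n$ the equation $\Delta_\ell\Delta_1\varepsilon_j\varepsilon_{ij}=-1$ holds if and only if $(\ell,i,j)$ is listed in the following table: $$\begin{array}{c|c|c} i & \ell \bmod 4 & j\\ \hline 0 & 1 \text{ or } 1-\Delta_0\Delta_1 & 2\\ 0 & 3 \text{ or } 1+\Delta_0\Delta_1 & 0,1,3\\ \hline 1 & 1 \text{ or } 1-\Delta_0\Delta_1 & 3\\ 1 & 3 \text{ or } 1+\Delta_0\Delta_1 & 0,1,2\\ \hline 2 & 1 \text{ or } 1-\Delta_0\Delta_1 & 1,2,3\\ 2 & 3 \text{ or } 1+\Delta_0\Delta_1 & 0\\ \hline 3 & 1 \text{ or } 1-\Delta_0\Delta_1 & 1\\ 3 & 3 \text{ or } 1+\Delta_0\Delta_1 & 0,2,3 \end{array}$$ -/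

import Mathlib

open Bundle Module
open scoped Manifold ContDiff

noncomputable section

namespace SpinorConnection

/-! ### The modified Pauli matrices and their signs -/

/-- The modified Pauli matrices `τ₀ = 1`, `τ₁ = σ₁`, `τ₂ = i σ₂`, `τ₃ = σ₃`. -/
def tau : Fin 4 → Matrix (Fin 2) (Fin 2) ℤ :=
  ![!![1, 0; 0, 1], !![0, 1; 1, 0], !![0, 1; -1, 0], !![1, 0; 0, -1]]

/-- The sign `ε_j`, the symmetry of `τ_j`. -/
def eps : Fin 4 → ℤ := ![1, 1, -1, 1]

/-- The sign `ε_{ij}` which appears when `τ_i` and `τ_j` are permuted. -/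
def epsComm : Fin 4 → Fin 4 → ℤ :=
  ![![1, 1, 1, 1], ![1, 1, -1, -1], ![1, -1, 1, -1], ![1, -1, -1, 1]]

theorem tau_transpose (j : Fin 4) : (tau j).transpose = eps j • tau j := by
  revert j; decide

theorem tau_mul_tau (i j : Fin 4) : tau i * tau j = epsComm i j • (tau j * tau i) := by
  revert i j; decide

/-- The rows of the left table, `ℓ mod 4 = 1`, and of the right table, `ℓ mod 4 = 1 - Δ₀Δ₁`:
the values of `j` for `i = 0, 1, 2, 3`. -/
def rowMinus : Fin 4 → Finset (Fin 4) := ![{2}, {3}, {1, 2, 3}, {1}]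

/-- The rows of the left table, `ℓ mod 4 = 3`, and of the right table, `ℓ mod 4 = 1 + Δ₀Δ₁`:
the values of `j` for `i = 0, 1, 2, 3`. -/
def rowPlus : Fin 4 → Finset (Fin 4) := ![{0, 1, 3}, {0, 1, 2}, {0}, {0, 2, 3}]

/-- The triple `(ℓ, i, j)` is listed in the table; `δ` stands for the product `Δ₀Δ₁`. -/
def InTable (δ : ℤ) (ℓ : ℕ) (i j : Fin 4) : Prop :=
  (((ℓ : ℤ) ≡ 1 [ZMOD 4] ∨ (ℓ : ℤ) ≡ 1 - δ [ZMOD 4]) ∧ j ∈ rowMinus i) ∨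
  (((ℓ : ℤ) ≡ 3 [ZMOD 4] ∨ (ℓ : ℤ) ≡ 1 + δ [ZMOD 4]) ∧ j ∈ rowPlus i)

/-! ### Algebra of gamma matrices -/

section Algebra

variable {𝕜 : Type*} [RCLike 𝕜] {T : Type*} [AddCommGroup T] [Module ℝ T]
  {W : Type*} [AddCommGroup W] [Module ℝ W] [Module 𝕜 W] [IsScalarTower ℝ 𝕜 W]

/-- The antisymmetrized product `γ_{v₁ ⋯ v_k} = γ_{[v₁} ⋯ γ_{v_k]}` (of total weight one). -/
def gammaAnti (γ : T →ₗ[ℝ] Module.End 𝕜 W) {k : ℕ} (v : Fin k → T) : Module.End 𝕜 W :=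
  ((Nat.factorial k : 𝕜)⁻¹) • ∑ s : Equiv.Perm (Fin k),
    (Equiv.Perm.sign s : ℤ) • (List.ofFn fun a => γ (v (s a))).prod

/-- The endomorphism `(1/ℓ!) F_{i₁ ⋯ i_ℓ} γ^{i₁ ⋯ i_ℓ}` of an alternating form `F`. Here `b` is a
basis, `F_{i₁ ⋯ i_ℓ}` are the components of `F` with respect to it, and the indices of the
`γ`-matrices are raised with the nondegenerate bilinear form `B`. -/
def formEnd [FiniteDimensional ℝ T] (γ : T →ₗ[ℝ] Module.End 𝕜 W)
    (B : LinearMap.BilinForm ℝ T) (hB : B.Nondegenerate) {ℓ : ℕ}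
    (F : T [⋀^Fin ℓ]→ₗ[ℝ] 𝕜) : Module.End 𝕜 W :=
  let b := Module.finBasis ℝ T
  ((Nat.factorial ℓ : 𝕜)⁻¹) • ∑ f : Fin ℓ → Fin (finrank ℝ T),
    F (fun a => b (f a)) • gammaAnti γ (fun a => B.dualBasis hB b (f a))

/-- The endomorphism `1 ⊗ m` of `W ⊕ W = W ⊗ 𝕜²`. -/
def twist (m : Matrix (Fin 2) (Fin 2) ℤ) : Module.End 𝕜 (W × W) :=
  LinearMap.prod
    (m 0 0 • LinearMap.fst 𝕜 W W + m 0 1 • LinearMap.snd 𝕜 W W)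
    (m 1 0 • LinearMap.fst 𝕜 W W + m 1 1 • LinearMap.snd 𝕜 W W)

/-- The endomorphism `Φ ⊗ m` of `W ⊕ W`. -/
def tensorTwist (Φ : Module.End 𝕜 W) (m : Matrix (Fin 2) (Fin 2) ℤ) : Module.End 𝕜 (W × W) :=
  (Φ.prodMap Φ) * twist m

/-- The bilinear form `C ⊗ m` on `W ⊕ W`,
`(C ⊗ m)(φ, ψ) = C(φ₁, (mψ)₁) + C(φ₂, (mψ)₂)`. -/
def formTwist (C : W →ₗ[𝕜] W →ₗ[𝕜] 𝕜) (m : Matrix (Fin 2) (Fin 2) ℤ) :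
    W × W →ₗ[𝕜] W × W →ₗ[𝕜] 𝕜 :=
  (C.compl₁₂ (LinearMap.fst 𝕜 W W) (LinearMap.fst 𝕜 W W ∘ₗ twist m)) +
  (C.compl₁₂ (LinearMap.snd 𝕜 W W) (LinearMap.snd 𝕜 W W ∘ₗ twist m))

/-- Clifford multiplication on `W ⊕ W`, acting on both summands. -/
def gammaDouble (γ : T →ₗ[ℝ] Module.End 𝕜 W) : T →ₗ[ℝ] Module.End 𝕜 (W × W) where
  toFun v := (γ v).prodMap (γ v)
  map_add' v w := by ext <;> simp
  map_smul' r v := by ext <;> simp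

end Algebra

/-! ### Charge conjugations -/

section ChargeConjugation

variable {𝕜 : Type*} [RCLike 𝕜] {V : Type*} [AddCommGroup V] [Module ℝ V] {η : QuadraticForm ℝ V}
  {S₀ : Type*} [AddCommGroup S₀] [Module ℝ S₀] [Module 𝕜 S₀] [IsScalarTower ℝ 𝕜 S₀]

/-- The `γ`-matrices of a module `ρ` over the Clifford algebra of `-η`, so that
`γ(v)γ(w) + γ(w)γ(v) = -2 η(v, w)`. -/
def gammaModel (ρ : CliffordAlgebra (-η) →ₐ[ℝ] Module.End 𝕜 S₀) : V →ₗ[ℝ] Module.End 𝕜 S₀ :=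
  ρ.toLinearMap ∘ₗ CliffordAlgebra.ι (-η)

/-- A charge conjugation on a spinor module: a nondegenerate spin-invariant `𝕜`-bilinear form
such that `C` and `C(·, γ_v ·)` are symmetric or skew symmetric. -/
structure ChargeConjugation (ρ : CliffordAlgebra (-η) →ₐ[ℝ] Module.End 𝕜 S₀) where
  form : S₀ →ₗ[𝕜] S₀ →ₗ[𝕜] 𝕜
  nondegenerate : ∀ φ, (∀ ψ, form φ ψ = 0) → φ = 0
  spin_invariant : ∀ h ∈ spinGroup (-η), ∀ φ ψ, form (ρ h φ) (ρ h ψ) = form φ ψ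
  symm_zero : (∀ φ ψ, form ψ φ = form φ ψ) ∨ (∀ φ ψ, form ψ φ = -form φ ψ)
  symm_one : (∀ φ ψ v, form ψ (gammaModel ρ v φ) = form φ (gammaModel ρ v ψ)) ∨
    (∀ φ ψ v, form ψ (gammaModel ρ v φ) = -form φ (gammaModel ρ v ψ))

namespace ChargeConjugation

variable {ρ : CliffordAlgebra (-η) →ₐ[ℝ] Module.End 𝕜 S₀}

/-- The map `C_k`, with values in `k`-forms: `C_k(φ ⊗ ψ)(v₁, …, v_k) = C(φ, γ_{v₁ ⋯ v_k} ψ)`. -/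
def proj (C : ChargeConjugation ρ) (k : ℕ) (φ ψ : S₀) (v : Fin k → V) : 𝕜 :=
  C.form φ (gammaAnti (gammaModel ρ) v ψ)

open Classical in
/-- The symmetry `Δ_k` of `C_k`: `1` if `C_k` is symmetric, and `-1` otherwise. -/
def sign (C : ChargeConjugation ρ) (k : ℕ) : ℤ :=
  if ∀ φ ψ v, C.proj k ψ φ v = C.proj k φ ψ v then 1 else -1

end ChargeConjugation

end ChargeConjugation

/-! ### Pseudo-Riemannian metrics, spin structures, connections -/

section Geometry

variable {E : Type*} [NormedAddCommGroup E] [NormedSpace ℝ E]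
  {H : Type*} [TopologicalSpace H] (I : ModelWithCorners ℝ E H)
  (M : Type*) [TopologicalSpace M] [ChartedSpace H M]

/-- A smooth pseudo-Riemannian metric. -/
structure PseudoRiemannianMetric [IsManifold I ∞ M] where
  val (x : M) : TangentSpace I x →L[ℝ] TangentSpace I x →L[ℝ] ℝ
  symm (x : M) (v w : TangentSpace I x) : val x v w = val x w v
  nondegenerate (x : M) (v : TangentSpace I x) : (∀ w, val x v w = 0) → v = 0
  contMDiff : ContMDiff I (I.prod 𝓘(ℝ, E →L[ℝ] E →L[ℝ] ℝ)) ∞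
    (fun x => TotalSpace.mk' (E →L[ℝ] E →L[ℝ] ℝ)
      (E := fun x : M => TangentSpace I x →L[ℝ] TangentSpace I x →L[ℝ] ℝ) x (val x))

variable {I M}

namespace PseudoRiemannianMetric

variable [IsManifold I ∞ M]

/-- The metric at a point, as an algebraic bilinear form. -/
def bilin (g : PseudoRiemannianMetric I M) (x : M) : LinearMap.BilinForm ℝ (TangentSpace I x) :=
  LinearMap.mk₂ ℝ (fun v w => g.val x v w) (by simp) (by simp) (by simp) (by simp)

theorem bilin_nondegenerate (g : PseudoRiemannianMetric I M) (x : M) :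
    (g.bilin x).Nondegenerate :=
  ⟨fun v hv => g.nondegenerate x v hv,
    fun v hv => g.nondegenerate x v fun w => by rw [g.symm]; exact hv w⟩

end PseudoRiemannianMetric

/-- Differentiability at `x` of a section of a vector bundle with model fibre `F`. -/
abbrev SectionDiffAt (I : ModelWithCorners ℝ E H) (F : Type*) [NormedAddCommGroup F]
    [NormedSpace ℝ F] {W : M → Type*} [TopologicalSpace (TotalSpace F W)]
    [∀ x, TopologicalSpace (W x)] [FiberBundle F W] (σ : Π x, W x) (x : M) : Prop :=
  MDifferentiableAt I (I.prod 𝓘(ℝ, F)) (fun y => TotalSpace.mk' F y (σ y)) x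

/-- `nabla` is the Levi-Civita connection of `g`: it is torsion free and metric. -/
def IsLeviCivita [FiniteDimensional ℝ E] [IsManifold I ∞ M] (g : PseudoRiemannianMetric I M)
    (nabla : CovariantDerivative I E (TangentSpace I : M → Type _)) : Prop :=
  nabla.torsion = 0 ∧
  ∀ (x : M) (X Y : Π x : M, TangentSpace I x) (Z : TangentSpace I x),
    SectionDiffAt I E X x → SectionDiffAt I E Y x →
    mvfderiv I (fun y => g.val y (X y) (Y y)) x Z =
      g.val x (nabla X x Z) (Y x) + g.val x (X x) (nabla Y x Z)

section SpinStructure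

variable {𝕜 : Type*} [RCLike 𝕜] {V : Type*} [AddCommGroup V] [Module ℝ V] {η : QuadraticForm ℝ V}
  {S₀ : Type*} [AddCommGroup S₀] [Module ℝ S₀] [Module 𝕜 S₀] [IsScalarTower ℝ 𝕜 S₀]
  {F : Type*} [NormedAddCommGroup F] [NormedSpace ℝ F]

/-- A spin structure on `(M, g)`, together with an identification of the vector bundle `S` with
the spinor bundle associated to it and to the Clifford module `ρ` on `S₀`; the metric has the type
of the model quadratic space `(V, η)`. It is given by local spin frames, one around each point `p`.
A spin frame on an open set consists of a smooth orthonormal frame of `TM`, written as isometries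
`vecFrame p x : V ≃ T_x M`, and of a smooth frame `spinFrame p x : S₀ ≃ S_x` of `S`. Two spin
frames differ by elements `h` of the spin group, where `h` acts on `V` through the covering
`v ↦ h v h⁻¹` of the orthogonal group (`star h = h⁻¹`) and on `S₀` through `ρ`.
(The values of the frames outside their domain are irrelevant.) -/
structure SpinStructure [IsManifold I ∞ M] (g : PseudoRiemannianMetric I M)
    (ρ : CliffordAlgebra (-η) →ₐ[ℝ] Module.End 𝕜 S₀) (F : Type*) [NormedAddCommGroup F]
    [NormedSpace ℝ F] (S : M → Type*) [TopologicalSpace (TotalSpace F S)]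
    [∀ x, AddCommGroup (S x)] [∀ x, Module ℝ (S x)] [∀ x, Module 𝕜 (S x)]
    [∀ x, TopologicalSpace (S x)] [FiberBundle F S] [VectorBundle ℝ F S] where
  domain : M → Set M
  isOpen_domain (p : M) : IsOpen (domain p)
  mem_domain (p : M) : p ∈ domain p
  vecFrame (p x : M) : V ≃ₗ[ℝ] TangentSpace I x
  spinFrame (p x : M) : S₀ ≃ₗ[𝕜] S x
  vecFrame_isometry (p : M) : ∀ x ∈ domain p, ∀ v,
    g.val x (vecFrame p x v) (vecFrame p x v) = η v
  vecFrame_smooth (p : M) (v : V) : ContMDiffOn I (I.prod 𝓘(ℝ, E)) ∞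
    (fun x => TotalSpace.mk' E (E := (TangentSpace I : M → Type _)) x (vecFrame p x v)) (domain p)
  spinFrame_smooth (p : M) (φ : S₀) : ContMDiffOn I (I.prod 𝓘(ℝ, F)) ∞
    (fun x => TotalSpace.mk' F x (spinFrame p x φ)) (domain p)
  transition (p q : M) : ∀ x ∈ domain p ∩ domain q, ∃ h ∈ spinGroup (-η),
    (∀ v, CliffordAlgebra.ι (-η) ((vecFrame p x).symm (vecFrame q x v)) =
      h * CliffordAlgebra.ι (-η) v * star h) ∧
    (∀ φ, spinFrame q x φ = spinFrame p x (ρ h φ))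

/-- The Lie algebra `spin(V)` inside the Clifford algebra, spanned by the commutators of
vectors. -/
def spinLieAlgebra (Q : QuadraticForm ℝ V) : Submodule ℝ (CliffordAlgebra Q) :=
  Submodule.span ℝ {a | ∃ v w, a = CliffordAlgebra.ι Q v * CliffordAlgebra.ι Q w -
    CliffordAlgebra.ι Q w * CliffordAlgebra.ι Q v}

namespace SpinStructure

variable [IsManifold I ∞ M] {g : PseudoRiemannianMetric I M}
  {ρ : CliffordAlgebra (-η) →ₐ[ℝ] Module.End 𝕜 S₀}
  {S : M → Type*} [TopologicalSpace (TotalSpace F S)]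
  [∀ x, AddCommGroup (S x)] [∀ x, Module ℝ (S x)] [∀ x, Module 𝕜 (S x)]
  [∀ x, IsScalarTower ℝ 𝕜 (S x)]
  [∀ x, TopologicalSpace (S x)] [FiberBundle F S] [VectorBundle ℝ F S]

/-- Clifford multiplication `T_x M → End(S_x)`, computed in the spin frame around `x` (it does
not depend on the spin frame). -/
def gamma (P : SpinStructure g ρ F S) (x : M) :
    TangentSpace I x →ₗ[ℝ] Module.End 𝕜 (S x) where
  toFun v := (P.spinFrame x x).toLinearMap ∘ₗ
    gammaModel ρ ((P.vecFrame x x).symm v) ∘ₗ (P.spinFrame x x).symm.toLinearMap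
  map_add' v w := by ext φ; simp
  map_smul' r v := by
    ext φ
    have h (a : S₀) : P.spinFrame x x (r • a) = r • P.spinFrame x x a := by
      rw [← algebraMap_smul 𝕜 r a, map_smul, algebraMap_smul]
    simp [h]

/-- The charge conjugation on `S_x`, computed in the spin frame around `x` (it does not depend on
the spin frame). -/
def form (P : SpinStructure g ρ F S) (C : ChargeConjugation ρ) (x : M) :
    S x →ₗ[𝕜] S x →ₗ[𝕜] 𝕜 :=
  C.form.compl₁₂ (P.spinFrame x x).symm.toLinearMap (P.spinFrame x x).symm.toLinearMap

/-- `nablaS` is the connection on `S` induced by the connection `nabla` on `TM`: in each spin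
frame, the connection form of `nablaS` is `ρ(a)`, where `a` is the connection form of `nabla`
lifted to `spin(V)` along the differential `a ↦ [a, ·]` of the covering of the orthogonal group. -/
def IsInducedConnection [∀ x, IsTopologicalAddGroup (S x)] [∀ x, ContinuousSMul ℝ (S x)]
    (P : SpinStructure g ρ F S)
    (nabla : CovariantDerivative I E (TangentSpace I : M → Type _))
    (nablaS : CovariantDerivative I F S) : Prop :=
  ∀ (p : M), ∀ x ∈ P.domain p, ∀ X : TangentSpace I x, ∃ a ∈ spinLieAlgebra (-η),
    (∀ v, a * CliffordAlgebra.ι (-η) v - CliffordAlgebra.ι (-η) v * a =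
      CliffordAlgebra.ι (-η)
        ((P.vecFrame p x).symm (nabla (fun y => P.vecFrame p y v) x X))) ∧
    (∀ φ, nablaS (fun y => P.spinFrame p y φ) x X = P.spinFrame p x (ρ a φ))

end SpinStructure

end SpinStructure

section Connections

variable {F : Type*} [NormedAddCommGroup F] [NormedSpace ℝ F]
  {W : M → Type*} [TopologicalSpace (TotalSpace F W)]
  [∀ x, AddCommGroup (W x)] [∀ x, Module ℝ (W x)]
  [∀ x, TopologicalSpace (W x)] [∀ x, IsTopologicalAddGroup (W x)] [∀ x, ContinuousSMul ℝ (W x)]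
  [FiberBundle F W]

/-- The connection `D + A` for an `End(W)`-valued one-form `A`. -/
def addOneForm [FiniteDimensional ℝ E] (D : CovariantDerivative I F W)
    (A : Π x : M, TangentSpace I x →ₗ[ℝ] W x →ₗ[ℝ] W x) : CovariantDerivative I F W where
  toFun σ x :=
    haveI : T2Space (TangentSpace I x) := inferInstanceAs (T2Space E)
    haveI : FiniteDimensional ℝ (TangentSpace I x) := inferInstanceAs (FiniteDimensional ℝ E)
    D σ x + LinearMap.toContinuousLinearMap ((A x).flip (σ x))
  isCovariantDerivativeOnUniv :=
    { add := fun hσ hσ' _ => by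
        rw [D.isCovariantDerivativeOnUniv.add hσ hσ']
        simp
        abel
      leibniz := fun hσ hg _ => by
        rw [D.isCovariantDerivativeOnUniv.leibniz hσ hg]
        simp
        abel }

theorem addOneForm_apply [FiniteDimensional ℝ E] (D : CovariantDerivative I F W)
    (A : Π x : M, TangentSpace I x →ₗ[ℝ] W x →ₗ[ℝ] W x) (σ : Π x, W x) (x : M)
    (X : TangentSpace I x) : addOneForm D A σ x X = D σ x X + A x X (σ x) := rfl

/-- The direct sum of two connections. -/
def directSum {F' : Type*} [NormedAddCommGroup F'] [NormedSpace ℝ F']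
    {W' : M → Type*} [TopologicalSpace (TotalSpace F' W')]
    [∀ x, AddCommGroup (W' x)] [∀ x, Module ℝ (W' x)]
    [∀ x, TopologicalSpace (W' x)] [∀ x, IsTopologicalAddGroup (W' x)]
    [∀ x, ContinuousSMul ℝ (W' x)] [FiberBundle F' W']
    (D : CovariantDerivative I F W) (D' : CovariantDerivative I F' W') :
    CovariantDerivative I (F × F') (W ×ᵇ W') where
  toFun σ x := (D (fun y => (σ y).1) x).prod (D' (fun y => (σ y).2) x)
  isCovariantDerivativeOnUniv := by
    have h1 {σ : Π x, (W ×ᵇ W') x} {x : M} (h : SectionDiffAt I (F × F') σ x) :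
        SectionDiffAt I F (fun y => (σ y).1) x := by
      rw [SectionDiffAt, mdifferentiableAt_section] at h ⊢
      exact (ContinuousLinearMap.fst ℝ F F').mdifferentiableAt.comp x h
    have h2 {σ : Π x, (W ×ᵇ W') x} {x : M} (h : SectionDiffAt I (F × F') σ x) :
        SectionDiffAt I F' (fun y => (σ y).2) x := by
      rw [SectionDiffAt, mdifferentiableAt_section] at h ⊢
      exact (ContinuousLinearMap.snd ℝ F F').mdifferentiableAt.comp x h
    refine ⟨fun {σ σ' x} hσ hσ' _ => ?_, fun {σ g x} hσ hg _ => ?_⟩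
    · have e1 := D.isCovariantDerivativeOnUniv.add (h1 hσ) (h1 hσ')
      have e2 := D'.isCovariantDerivativeOnUniv.add (h2 hσ) (h2 hσ')
      ext X
      · exact congrArg (fun L => L X) e1
      · exact congrArg (fun L => L X) e2
    · have e1 := D.isCovariantDerivativeOnUniv.leibniz (h1 hσ) hg
      have e2 := D'.isCovariantDerivativeOnUniv.leibniz (h2 hσ) hg
      ext X
      · exact congrArg (fun L => L X) e1
      · exact congrArg (fun L => L X) e2

variable [IsManifold I ∞ M] {𝕜 : Type*} [RCLike 𝕜] [∀ x, Module 𝕜 (W x)]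
  [∀ x, IsScalarTower ℝ 𝕜 (W x)]

/-- `DC` is the connection `D^C` associated to `D` and the bilinear form `B`: the connection
`D ⊗ 1 + 1 ⊗ D^C` makes `B` parallel. -/
def IsChargeDual (B : Π x : M, W x →ₗ[𝕜] W x →ₗ[𝕜] 𝕜) (D DC : CovariantDerivative I F W) : Prop :=
  ∀ (x : M) (σ τ : Π x, W x) (X : TangentSpace I x),
    SectionDiffAt I F σ x → SectionDiffAt I F τ x →
    mvfderiv I (fun y => B y (σ y) (τ y)) x X = B x (D σ x X) (τ x) + B x (σ x) (DC τ x X)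

/-- `((D̂_X γ)(Y)) ξ = D_X (γ(Y) ξ) - γ(∇_X Y) ξ - γ(Y) D^C_X ξ`. -/
def hatD (nabla : CovariantDerivative I E (TangentSpace I : M → Type _))
    (γ : Π x : M, TangentSpace I x →ₗ[ℝ] Module.End 𝕜 (W x)) (D DC : CovariantDerivative I F W)
    (X Y : Π x : M, TangentSpace I x) (ξ : Π x, W x) (x : M) : W x :=
  D (fun y => γ y (Y y) (ξ y)) x (X x) - γ x (nabla Y x (X x)) (ξ x) - γ x (Y x) (DC ξ x (X x))

/-- The connection `D` on `W` is admissible: `D̂γ` is skew symmetric. (For a nondegenerate form `B`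
the connection `D^C` exists and is unique.) -/
def Admissible (nabla : CovariantDerivative I E (TangentSpace I : M → Type _))
    (γ : Π x : M, TangentSpace I x →ₗ[ℝ] Module.End 𝕜 (W x))
    (B : Π x : M, W x →ₗ[𝕜] W x →ₗ[𝕜] 𝕜) (D : CovariantDerivative I F W) : Prop :=
  ∃ DC : CovariantDerivative I F W, IsChargeDual B D DC ∧
    ∀ (x : M) (X Y : Π x : M, TangentSpace I x) (ξ : Π x, W x),
      SectionDiffAt I E X x → SectionDiffAt I E Y x → SectionDiffAt I F ξ x →
      hatD nabla γ D DC X Y ξ x = - hatD nabla γ D DC Y X ξ x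

end Connections

section Twisted

variable {𝕜 : Type*} [RCLike 𝕜] {V : Type*} [AddCommGroup V] [Module ℝ V] {η : QuadraticForm ℝ V}
  {S₀ : Type*} [AddCommGroup S₀] [Module ℝ S₀] [Module 𝕜 S₀] [IsScalarTower ℝ 𝕜 S₀]
  {F : Type*} [NormedAddCommGroup F] [NormedSpace ℝ F]
  [IsManifold I ∞ M] {g : PseudoRiemannianMetric I M}
  {ρ : CliffordAlgebra (-η) →ₐ[ℝ] Module.End 𝕜 S₀}
  {S : M → Type*} [TopologicalSpace (TotalSpace F S)]
  [∀ x, AddCommGroup (S x)] [∀ x, Module ℝ (S x)] [∀ x, Module 𝕜 (S x)]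
  [∀ x, IsScalarTower ℝ 𝕜 (S x)]
  [∀ x, TopologicalSpace (S x)] [FiberBundle F S] [VectorBundle ℝ F S]

/-- The `End(S ⊕ S)`-valued one-form `X ↦ (1/ℓ!) F_{i₁ ⋯ i_ℓ} γ^{i₁ ⋯ i_ℓ} γ(X) ⊗ τ_j`. -/
def contribution [FiniteDimensional ℝ E] (P : SpinStructure g ρ F S) {ℓ : ℕ}
    (α : Π x : M, TangentSpace I x [⋀^Fin ℓ]→ₗ[ℝ] 𝕜) (j : Fin 4) (x : M) :
    TangentSpace I x →ₗ[ℝ] (S ×ᵇ S) x →ₗ[ℝ] (S ×ᵇ S) x :=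
  haveI : FiniteDimensional ℝ (TangentSpace I x) := inferInstanceAs (FiniteDimensional ℝ E)
  LinearMap.mk₂ ℝ
    (fun X ξ => tensorTwist
      (formEnd (P.gamma x) (g.bilin x) (g.bilin_nondegenerate x) (α x) * P.gamma x X) (tau j) ξ)
    (by intro X Y ξ; ext <;> simp [tensorTwist])
    (by intro r X ξ; ext <;> simp [tensorTwist])
    (by intro X ξ ζ; simp)
    (by
      intro r X ξ
      rw [← algebraMap_smul 𝕜 r ξ, map_smul, algebraMap_smul])

/-- Admissibility of a connection on the twisted spinor bundle `S ⊕ S` with charge conjugation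
`C ⊗ τ_i`. -/
def TwistedAdmissible (P : SpinStructure g ρ F S) (C : ChargeConjugation ρ)
    [∀ x, IsTopologicalAddGroup (S x)] [∀ x, ContinuousSMul ℝ (S x)]
    (nabla : CovariantDerivative I E (TangentSpace I : M → Type _)) (i : Fin 4)
    (D : CovariantDerivative I (F × F) (S ×ᵇ S)) : Prop :=
  Admissible (𝕜 := 𝕜) nabla (fun x => gammaDouble (P.gamma x))
    (fun x => formTwist (P.form C x) (tau i)) D

end Twisted

end Geometry

end SpinorConnection

end

/-! Let `Θ` be the left factor of `𝒜(X) = Θ γ(X)`. Reversing a product of `ℓ` anticommuting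
`γ`-matrices costs the sign `(-1)^(ℓ choose 2)`, so `Θ` is symmetric up to a sign `u` with respect
to `C ⊗ τ_i`, as `γ(X)` is up to the sign `t = Δ₀Δ₁`. Since `D^C` is determined by `D`, passing from
`D` to `D + 𝒜` subtracts the adjoint of `𝒜` from it, and by the Clifford relation the symmetrization
of `D̂γ` changes by `-2 g(X, Y) (1 + u t) Θ`. Here `Θ ≠ 0` wherever the form does not vanish: the
graded commutator with `γ(v)` contracts a form with `v`, so by induction on the degree a form is
determined by its action on any nonzero Clifford module. The same nonvanishing yields
`Δ_ℓ Δ₁ = (Δ₀Δ₁)^(ℓ+1) (-1)^(ℓ choose 2)`, which has period `4` in `ℓ`. -/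

noncomputable section

namespace SpinorConnection

/-! ### Alternating forms as endomorphisms -/

section Contraction

variable {R : Type*} [CommRing R] {K : Type*} [CommRing K] [Algebra R K]
  {A : Type*} [Ring A] [Algebra K A] [Algebra R A] [IsScalarTower R K A]
  {T : Type*} [AddCommGroup T] [Module R T] {ι : Type*} [Fintype ι] {ℓ : ℕ}

theorem curryLeft_curryLeft_swap {N : Type*} [AddCommGroup N] [Module R N]
    (F : T [⋀^Fin (ℓ + 2)]→ₗ[R] N) (u v : T) :
    (F.curryLeft u).curryLeft v = -(F.curryLeft v).curryLeft u := by
  have alt : (AlternatingMap.curryLeftLinearMap ∘ₗ F.curryLeft).IsAlt := F.curryLeft_same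
  exact (alt.neg v u).symm

/-- The complete contraction `F_{i₁ ⋯ i_ℓ} Γ^{i₁} ⋯ Γ^{i_ℓ}` of the components of an alternating
form with respect to the vectors `b i` with products of elements of an algebra. -/
def contraction (Γ : ι → A) (b : ι → T) : (T [⋀^Fin ℓ]→ₗ[R] K) →ₗ[R] A where
  toFun F := ∑ f : Fin ℓ → ι, F (b ∘ f) • (List.ofFn (Γ ∘ f)).prod
  map_add' F G := by simp only [AlternatingMap.add_apply, add_smul, Finset.sum_add_distrib]
  map_smul' r F := by
    simp only [AlternatingMap.smul_apply, smul_assoc, Finset.smul_sum, RingHom.id_apply]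

theorem contraction_apply (Γ : ι → A) (b : ι → T) (F : T [⋀^Fin ℓ]→ₗ[R] K) :
    contraction Γ b F = ∑ f : Fin ℓ → ι, F (b ∘ f) • (List.ofFn (Γ ∘ f)).prod := rfl

theorem contraction_zero (Γ : ι → A) (b : ι → T) (F : T [⋀^Fin 0]→ₗ[R] K) :
    contraction Γ b F = algebraMap K A (F ![]) := by
  simp [contraction_apply, Matrix.empty_eq, Algebra.algebraMap_eq_smul_one]

theorem contraction_succ (Γ : ι → A) (b : ι → T) (F : T [⋀^Fin (ℓ + 1)]→ₗ[R] K) :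
    contraction Γ b F = ∑ i, Γ i * contraction Γ b (F.curryLeft (b i)) := by
  simp only [contraction_apply, Finset.mul_sum, mul_smul_comm]
  rw [← (Fin.consEquiv fun _ : Fin (ℓ + 1) => ι).sum_comp, Fintype.sum_prod_type]
  refine Fintype.sum_congr _ _ fun i => Fintype.sum_congr _ _ fun f => ?_
  have hcons : b ∘ Fin.cons i f = Matrix.vecCons (b i) (b ∘ f) := Fin.comp_cons b i f
  simp [Fin.consEquiv, hcons, Function.comp_def]

section Clifford

variable {γ : T →ₗ[R] A} {Γ : ι → A} {b : Basis ι R T}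

theorem mul_contraction_eq_sub_sum
    (hγ : ∀ v i, γ v * Γ i + Γ i * γ v = (-2 * b.repr v i) • 1)
    (v : T) (F : T [⋀^Fin (ℓ + 1)]→ₗ[R] K) :
    γ v * contraction Γ b F = (-2 : R) • contraction Γ b (F.curryLeft v) -
      ∑ i, Γ i * (γ v * contraction Γ b (F.curryLeft (b i))) := by
  have expand : contraction Γ b (F.curryLeft v) =
      ∑ i, b.repr v i • contraction Γ b (F.curryLeft (b i)) := by
    conv_lhs => rw [← b.sum_repr v]
    simp only [map_sum, map_smul]
  rw [expand, contraction_succ, Finset.mul_sum, Finset.smul_sum, ← Finset.sum_sub_distrib]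
  refine Fintype.sum_congr _ _ fun i => ?_
  rw [← mul_assoc, ← mul_assoc, eq_sub_of_add_eq (hγ v i), sub_mul, smul_mul_assoc, one_mul,
    mul_smul]

theorem mul_contraction (hγ : ∀ v i, γ v * Γ i + Γ i * γ v = (-2 * b.repr v i) • 1)
    (v : T) (F : T [⋀^Fin (ℓ + 1)]→ₗ[R] K) :
    γ v * contraction Γ b F = (-1 : R) ^ (ℓ + 1) • (contraction Γ b F * γ v) -
      (2 * (ℓ + 1) : R) • contraction Γ b (F.curryLeft v) := by
  induction ℓ with
  | zero =>
    have central (i : ι) : γ v * contraction Γ b (F.curryLeft (b i)) =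
        contraction Γ b (F.curryLeft (b i)) * γ v := by
      rw [contraction_zero, Algebra.commutes]
    simp only [mul_contraction_eq_sub_sum hγ, central, ← mul_assoc, ← Finset.sum_mul,
      ← contraction_succ]
    push_cast
    module
  | succ ℓ ih =>
    have moved (i : ι) : Γ i * (γ v * contraction Γ b (F.curryLeft (b i))) =
        (-1 : R) ^ (ℓ + 1) • (Γ i * contraction Γ b (F.curryLeft (b i)) * γ v) +
        (2 * (ℓ + 1) : R) • (Γ i * contraction Γ b ((F.curryLeft v).curryLeft (b i))) := by
      rw [ih, curryLeft_curryLeft_swap, map_neg, smul_neg, sub_neg_eq_add, mul_add,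
        mul_smul_comm, mul_smul_comm, mul_assoc]
    simp only [mul_contraction_eq_sub_sum hγ v F, moved, Finset.sum_add_distrib,
      ← Finset.smul_sum, ← Finset.sum_mul, ← contraction_succ]
    push_cast
    module

end Clifford

theorem contraction_injective {R : Type*} [Field R] [CharZero R] {K : Type*} [Field K]
    [Algebra R K] {A : Type*} [Ring A] [Nontrivial A] [Algebra K A] [Algebra R A]
    [IsScalarTower R K A] [Module R T] {γ : T →ₗ[R] A} {Γ : ι → A} {b : Basis ι R T}
    (hγ : ∀ v i, γ v * Γ i + Γ i * γ v = (-2 * b.repr v i) • 1) :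
    Function.Injective (contraction Γ b : (T [⋀^Fin ℓ]→ₗ[R] K) → A) := by
  refine (injective_iff_map_eq_zero _).2 fun F hF => ?_
  induction ℓ with
  | zero =>
    rw [contraction_zero, map_eq_zero] at hF
    ext v
    rw [Subsingleton.elim v ![], hF, AlternatingMap.zero_apply]
  | succ ℓ ih =>
    have interior (v : T) : F.curryLeft v = 0 := by
      have h := mul_contraction hγ v F
      rw [hF, mul_zero, zero_mul, smul_zero, zero_sub, zero_eq_neg] at h
      have degree : (2 * (ℓ + 1) : R) ≠ 0 := by exact_mod_cast (by positivity : 2 * (ℓ + 1) ≠ 0)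
      exact ih _ ((smul_eq_zero.1 h).resolve_left degree)
    ext v
    rw [← Matrix.cons_head_tail v, ← AlternatingMap.curryLeft_apply_apply, interior]
    rfl

end Contraction

section FormEnd

variable {𝕜 : Type*} [RCLike 𝕜] {T : Type*} [AddCommGroup T] [Module ℝ T]
  {W : Type*} [AddCommGroup W] [Module ℝ W] [Module 𝕜 W] [IsScalarTower ℝ 𝕜 W]

/-- The Clifford relation `γ(v) γ(w) + γ(w) γ(v) = -2 B(v, w)`. -/
def IsCliffordMap (γ : T →ₗ[ℝ] Module.End 𝕜 W) (B : LinearMap.BilinForm ℝ T) : Prop :=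
  ∀ v w, γ v * γ w + γ w * γ v = (-2 * B v w) • (1 : Module.End 𝕜 W)

theorem sum_sign_smul_prod_perm {ι : Type*} [Fintype ι] {A : Type*} [Ring A] [Algebra 𝕜 A]
    (Γ : ι → A) (b : ι → T) {ℓ : ℕ} (F : T [⋀^Fin ℓ]→ₗ[ℝ] 𝕜) (s : Equiv.Perm (Fin ℓ)) :
    ∑ f : Fin ℓ → ι, F (b ∘ f) • (Equiv.Perm.sign s : ℤ) • (List.ofFn (Γ ∘ f ∘ s)).prod =
      ∑ f : Fin ℓ → ι, F (b ∘ f) • (List.ofFn (Γ ∘ f)).prod := by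
  rw [← (s.arrowCongr (Equiv.refl ι)).sum_comp]
  refine Fintype.sum_congr _ _ fun f => ?_
  have alternates : F (b ∘ f ∘ s.symm) = (Equiv.Perm.sign s : ℤ) • F (b ∘ f) := by
    rw [← Function.comp_assoc, F.map_perm, Equiv.Perm.sign_symm, Units.smul_def]
  have recover : (f ∘ s.symm) ∘ s = f := by funext a; simp
  have reindex : s.arrowCongr (Equiv.refl ι) f = f ∘ s.symm := rfl
  rw [reindex, alternates, recover, smul_assoc, smul_comm (F (b ∘ f)), smul_smul,
    Int.units_coe_mul_self, one_smul]

theorem formEnd_eq_contraction [FiniteDimensional ℝ T] (γ : T →ₗ[ℝ] Module.End 𝕜 W)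
    (B : LinearMap.BilinForm ℝ T) (hB : B.Nondegenerate) {ℓ : ℕ} (F : T [⋀^Fin ℓ]→ₗ[ℝ] 𝕜) :
    formEnd γ B hB F = (Nat.factorial ℓ : 𝕜)⁻¹ •
      contraction (γ ∘ B.dualBasis hB (finBasis ℝ T)) (finBasis ℝ T) F := by
  have average : (∑ f, F (finBasis ℝ T ∘ f) • gammaAnti γ (B.dualBasis hB (finBasis ℝ T) ∘ f)) =
      contraction (γ ∘ B.dualBasis hB (finBasis ℝ T)) (finBasis ℝ T) F := by
    simp only [gammaAnti, smul_comm (F _) (Nat.factorial ℓ : 𝕜)⁻¹, ← Finset.smul_sum]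
    rw [inv_smul_eq_iff₀ (by exact_mod_cast Nat.factorial_ne_zero ℓ)]
    simp only [Finset.smul_sum]
    rw [Finset.sum_comm]
    refine (Fintype.sum_congr _ _ fun s => sum_sign_smul_prod_perm
      (γ ∘ B.dualBasis hB (finBasis ℝ T)) (finBasis ℝ T) F s).trans ?_
    simp [contraction_apply, Fintype.card_perm, Nat.cast_smul_eq_nsmul]
  exact congrArg ((Nat.factorial ℓ : 𝕜)⁻¹ • ·) average

theorem formEnd_ne_zero [FiniteDimensional ℝ T] [Nontrivial W] {γ : T →ₗ[ℝ] Module.End 𝕜 W}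
    {B : LinearMap.BilinForm ℝ T} (hγ : IsCliffordMap γ B) (hB : B.Nondegenerate) {ℓ : ℕ}
    {F : T [⋀^Fin ℓ]→ₗ[ℝ] 𝕜} (hF : F ≠ 0) : formEnd γ B hB F ≠ 0 := by
  have dual (i) : B (B.dualBasis hB (finBasis ℝ T) i) = (finBasis ℝ T).coord i := by
    refine (finBasis ℝ T).ext fun j => ?_
    rw [LinearMap.BilinForm.apply_dualBasis_left, Basis.coord_apply, Basis.repr_self,
      Finsupp.single_apply]
  rw [formEnd_eq_contraction]
  refine smul_ne_zero (inv_ne_zero (by exact_mod_cast Nat.factorial_ne_zero ℓ)) ?_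
  refine (map_ne_zero_iff _ (contraction_injective (γ := γ) fun v i => ?_)).2 hF
  rw [Function.comp_apply, add_comm, hγ, dual, Basis.coord_apply]

end FormEnd

/-! ### Adjoint signs -/

section Reversal

theorem sign_revPerm (k : ℕ) :
    Equiv.Perm.sign (Fin.revPerm : Equiv.Perm (Fin k)) = (-1) ^ k.choose 2 := by
  have inversions (j : Fin k) : (∏ i ∈ Finset.Iio j,
      if Fin.revPerm i < Fin.revPerm j then (1 : ℤˣ) else -1) = (-1) ^ (j : ℕ) := by
    rw [Finset.prod_congr rfl (g := fun _ => (-1 : ℤˣ)), Finset.prod_const, Fin.card_Iio]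
    intro i hi
    simp [(Finset.mem_Iio.1 hi).le]
  rw [Equiv.Perm.sign_eq_prod_prod_Iio, Fintype.prod_congr _ _ inversions,
    Finset.prod_pow_eq_pow_sum, Fin.sum_univ_eq_sum_range (fun i => i), Finset.sum_range_id,
    Nat.choose_two_right]

theorem sum_sign_smul_reverse_prod {A : Type*} [Ring A] {k : ℕ} (Γ : Fin k → A) :
    ∑ s : Equiv.Perm (Fin k), (Equiv.Perm.sign s : ℤ) • (List.ofFn (Γ ∘ s)).reverse.prod =
      (-1 : ℤ) ^ k.choose 2 •
        ∑ s : Equiv.Perm (Fin k), (Equiv.Perm.sign s : ℤ) • (List.ofFn (Γ ∘ s)).prod := by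
  rw [← Equiv.sum_comp (Equiv.mulRight Fin.revPerm), Finset.smul_sum]
  refine Fintype.sum_congr _ _ fun s => ?_
  have unreverse : (List.ofFn (Γ ∘ (s * Fin.revPerm : Equiv.Perm (Fin k)))).reverse =
      List.ofFn (Γ ∘ s) := by
    refine List.ext_getElem (by simp) fun i h h' => ?_
    have : k - (k - 1 - i + 1) = i := by simp at h'; omega
    simp [Fin.rev, this]
  rw [Equiv.coe_mulRight, unreverse, Equiv.Perm.sign_mul, sign_revPerm, mul_comm, smul_smul]
  push_cast
  rfl

end Reversal

section Adjoint

variable {R : Type*} [CommRing R] {N : Type*} [AddCommGroup N] [Module R N]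

/-- The adjoint of `f` with respect to the bilinear form `C` is `c • f`; in the applications `c` is
a sign, so that `f` is selfadjoint or skew adjoint. -/
def HasAdjointSign (C : N →ₗ[R] N →ₗ[R] R) (c : R) (f : Module.End R N) : Prop :=
  ∀ φ ψ, C (f φ) ψ = c * C φ (f ψ)

variable {C : N →ₗ[R] N →ₗ[R] R} {c d : R} {f f' : Module.End R N}

namespace HasAdjointSign

theorem smul (hf : HasAdjointSign C c f) (r : R) :
    HasAdjointSign C c (r • f) := fun φ ψ => by
  simp only [LinearMap.smul_apply, map_smul, smul_eq_mul, hf φ ψ]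
  ring

theorem sum {ι : Type*} {s : Finset ι} {f : ι → Module.End R N}
    (hf : ∀ i ∈ s, HasAdjointSign C c (f i)) : HasAdjointSign C c (∑ i ∈ s, f i) := fun φ ψ => by
  simp only [LinearMap.sum_apply, map_sum, Finset.mul_sum]
  exact Finset.sum_congr rfl fun i hi => hf i hi φ ψ

theorem mul_apply (hf : HasAdjointSign C c f) (hf' : HasAdjointSign C d f') (φ ψ : N) :
    C ((f * f') φ) ψ = c * d * C φ ((f' * f) ψ) := by
  rw [Module.End.mul_apply, hf, hf', mul_assoc, Module.End.mul_apply]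

theorem mul_of_commute (hf : HasAdjointSign C c f) (hf' : HasAdjointSign C d f')
    (hcomm : Commute f f') : HasAdjointSign C (c * d) (f * f') := fun φ ψ => by
  rw [hf.mul_apply hf', hcomm.eq]

theorem commutator (hf : HasAdjointSign C c f) (hf' : HasAdjointSign C d f') :
    HasAdjointSign C (-(c * d)) (f * f' - f' * f) := fun φ ψ => by
  rw [LinearMap.sub_apply, LinearMap.sub_apply, map_sub, map_sub, LinearMap.sub_apply,
    hf.mul_apply hf', hf'.mul_apply hf]
  ring

theorem list_prod {L : List (Module.End R N)} (hL : ∀ f ∈ L, HasAdjointSign C c f) (φ ψ : N) :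
    C (L.prod φ) ψ = c ^ L.length * C φ (L.reverse.prod ψ) := by
  induction L generalizing φ ψ with
  | nil => simp
  | cons f L ih =>
    simp only [List.prod_cons, Module.End.mul_apply, List.length_cons, List.reverse_cons,
      List.prod_append, List.prod_nil, mul_one]
    rw [hL f List.mem_cons_self, ih fun g hg => hL g (List.mem_cons_of_mem f hg), pow_succ']
    ring

end HasAdjointSign

end Adjoint

section GammaAdjoint

variable {𝕜 : Type*} [RCLike 𝕜] {T : Type*} [AddCommGroup T] [Module ℝ T]
  {W : Type*} [AddCommGroup W] [Module ℝ W] [Module 𝕜 W] [IsScalarTower ℝ 𝕜 W]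
  {γ : T →ₗ[ℝ] Module.End 𝕜 W} {C : W →ₗ[𝕜] W →ₗ[𝕜] 𝕜} {c : 𝕜}

theorem hasAdjointSign_gammaAnti (hC : ∀ v, HasAdjointSign C c (γ v)) {k : ℕ} (v : Fin k → T) :
    HasAdjointSign C (c ^ k * (-1) ^ k.choose 2) (gammaAnti γ v) := by
  refine HasAdjointSign.smul (fun φ ψ => ?_) _
  set D : Equiv.Perm (Fin k) → List (Module.End 𝕜 W) := fun s => List.ofFn (γ ∘ v ∘ s)
  have product (s : Equiv.Perm (Fin k)) :
      C ((D s).prod φ) ψ = c ^ k * C φ ((D s).reverse.prod ψ) := by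
    have factors : ∀ f ∈ D s, HasAdjointSign C c f := by simp [D, List.mem_ofFn, hC]
    rw [HasAdjointSign.list_prod factors, List.length_ofFn]
  have reversal : ∑ s, (Equiv.Perm.sign s : ℤ) • (D s).reverse.prod =
      (-1 : ℤ) ^ k.choose 2 • ∑ s, (Equiv.Perm.sign s : ℤ) • (D s).prod :=
    sum_sign_smul_reverse_prod (γ ∘ v)
  calc C ((∑ s, (Equiv.Perm.sign s : ℤ) • (D s).prod) φ) ψ
    _ = c ^ k * C φ ((∑ s, (Equiv.Perm.sign s : ℤ) • (D s).reverse.prod) ψ) := by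
      simp only [LinearMap.sum_apply, LinearMap.smul_apply, map_sum, map_zsmul, product,
        Finset.mul_sum, mul_smul_comm]
    _ = c ^ k * (-1) ^ k.choose 2 * C φ ((∑ s, (Equiv.Perm.sign s : ℤ) • (D s).prod) ψ) := by
      rw [reversal, LinearMap.smul_apply, map_zsmul, zsmul_eq_mul, mul_assoc]
      push_cast
      rfl

theorem hasAdjointSign_formEnd [FiniteDimensional ℝ T] (hC : ∀ v, HasAdjointSign C c (γ v))
    {B : LinearMap.BilinForm ℝ T} (hB : B.Nondegenerate) {ℓ : ℕ} (F : T [⋀^Fin ℓ]→ₗ[ℝ] 𝕜) :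
    HasAdjointSign C (c ^ ℓ * (-1) ^ ℓ.choose 2) (formEnd γ B hB F) :=
  (HasAdjointSign.sum fun _ _ => (hasAdjointSign_gammaAnti hC _).smul _).smul _

end GammaAdjoint

section Table

theorem mem_rowMinus (i j : Fin 4) : j ∈ rowMinus i ↔ eps j * epsComm i j = -1 := by
  revert i j; decide

theorem mem_rowPlus (i j : Fin 4) : j ∈ rowPlus i ↔ eps j * epsComm i j = 1 := by
  revert i j; decide

/-- The sign `Δ_ℓ Δ₁` in terms of `δ = Δ₀ Δ₁`. -/
def degreeSign (δ : ℤ) (ℓ : ℕ) : ℤ := δ ^ (ℓ + 1) * (-1) ^ ℓ.choose 2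

variable {δ : ℤ}

theorem isUnit_degreeSign (hδ : IsUnit δ) (ℓ : ℕ) : IsUnit (degreeSign δ ℓ) :=
  (hδ.pow _).mul (isUnit_neg_one.pow _)

theorem degreeSign_periodic (hδ : IsUnit δ) : Function.Periodic (degreeSign δ) 4 := fun ℓ => by
  have hchoose : (ℓ + 4).choose 2 = ℓ.choose 2 + 2 * (2 * ℓ + 3) := by
    simp only [Nat.choose_succ_succ', Nat.choose_zero_right, Nat.choose_one_right, zero_add]
    ring
  have hsq : δ ^ 2 = 1 := Int.isUnit_sq hδ
  rw [degreeSign, degreeSign, hchoose, add_right_comm, pow_add, pow_add (-1), pow_mul (-1),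
    show δ ^ 4 = (δ ^ 2) ^ 2 by ring, hsq]
  norm_num

theorem degreeSign_eq_one_iff (hδ : IsUnit δ) (ℓ : ℕ) :
    degreeSign δ ℓ = 1 ↔ (ℓ : ℤ) ≡ 1 [ZMOD 4] ∨ (ℓ : ℤ) ≡ 1 - δ [ZMOD 4] := by
  rw [← (degreeSign_periodic hδ).map_mod_nat, Int.ModEq, Int.ModEq,
    show (ℓ : ℤ) % 4 = (ℓ % 4 : ℕ) from (Int.natCast_mod ℓ 4).symm]
  have hlt := ℓ.mod_lt (by norm_num : 4 > 0)
  rcases Int.isUnit_iff.1 hδ with rfl | rfl <;> interval_cases ℓ % 4 <;> decide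

theorem degreeSign_eq_neg_one_iff (hδ : IsUnit δ) (ℓ : ℕ) :
    degreeSign δ ℓ = -1 ↔ (ℓ : ℤ) ≡ 3 [ZMOD 4] ∨ (ℓ : ℤ) ≡ 1 + δ [ZMOD 4] := by
  rw [← (degreeSign_periodic hδ).map_mod_nat, Int.ModEq, Int.ModEq,
    show (ℓ : ℤ) % 4 = (ℓ % 4 : ℕ) from (Int.natCast_mod ℓ 4).symm]
  have hlt := ℓ.mod_lt (by norm_num : 4 > 0)
  rcases Int.isUnit_iff.1 hδ with rfl | rfl <;> interval_cases ℓ % 4 <;> decide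

theorem degreeSign_mul_eq_neg_one_iff (hδ : IsUnit δ) (ℓ : ℕ) (i j : Fin 4) :
    degreeSign δ ℓ * (eps j * epsComm i j) = -1 ↔ InTable δ ℓ i j := by
  rw [InTable, ← degreeSign_eq_one_iff hδ, ← degreeSign_eq_neg_one_iff hδ, mem_rowMinus,
    mem_rowPlus]
  rcases Int.isUnit_iff.1 (isUnit_degreeSign hδ ℓ) with h | h <;> simp [h]

end Table

namespace ChargeConjugation

variable {𝕜 : Type*} [RCLike 𝕜] {V : Type*} [AddCommGroup V] [Module ℝ V] {η : QuadraticForm ℝ V}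
  {S₀ : Type*} [AddCommGroup S₀] [Module ℝ S₀] [Module 𝕜 S₀] [IsScalarTower ℝ 𝕜 S₀]
  {ρ : CliffordAlgebra (-η) →ₐ[ℝ] Module.End 𝕜 S₀} (C : ChargeConjugation ρ) {k : ℕ}

theorem isUnit_sign (k : ℕ) : IsUnit (C.sign k) := by
  unfold sign
  split_ifs <;> decide

variable {C} in
theorem proj_swap_of_isUnit {r : ℤ} (hr : IsUnit r)
    (h : ∀ φ ψ v, C.proj k ψ φ v = (r : 𝕜) * C.proj k φ ψ v) (φ ψ : S₀) (v : Fin k → V) :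
    C.proj k ψ φ v = (C.sign k : 𝕜) * C.proj k φ ψ v := by
  unfold sign
  split_ifs with symmetric
  · simpa using symmetric φ ψ v
  · rcases Int.isUnit_iff.1 hr with rfl | rfl
    · exact absurd (by simpa using h) symmetric
    · exact h φ ψ v

theorem form_swap (φ ψ : S₀) : C.form ψ φ = (C.sign 0 : 𝕜) * C.form φ ψ := by
  obtain ⟨r, hr, h⟩ : ∃ r : ℤ, IsUnit r ∧ ∀ φ ψ, C.form ψ φ = (r : 𝕜) * C.form φ ψ := by
    rcases C.symm_zero with h | h
    · exact ⟨1, isUnit_one, by simpa using h⟩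
    · exact ⟨-1, isUnit_neg_one, by simpa using h⟩
  simpa [proj, gammaAnti] using
    proj_swap_of_isUnit (C := C) (k := 0) hr (by simpa [proj, gammaAnti] using h) φ ψ ![]

theorem form_gammaModel_swap (φ ψ : S₀) (v : V) :
    C.form ψ (gammaModel ρ v φ) = (C.sign 1 : 𝕜) * C.form φ (gammaModel ρ v ψ) := by
  obtain ⟨r, hr, h⟩ : ∃ r : ℤ, IsUnit r ∧
      ∀ φ ψ v, C.form ψ (gammaModel ρ v φ) = (r : 𝕜) * C.form φ (gammaModel ρ v ψ) := by
    rcases C.symm_one with h | h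
    · exact ⟨1, isUnit_one, by simpa using h⟩
    · exact ⟨-1, isUnit_neg_one, by simpa using h⟩
  have hproj (φ ψ : S₀) (w : Fin 1 → V) : C.proj 1 ψ φ w = (r : 𝕜) * C.proj 1 φ ψ w := by
    simpa [proj, gammaAnti] using h φ ψ (w 0)
  simpa [proj, gammaAnti] using proj_swap_of_isUnit hr hproj φ ψ ![v]

theorem hasAdjointSign_gammaModel (v : V) :
    HasAdjointSign C.form ((C.sign 0 * C.sign 1 : ℤ) : 𝕜) (gammaModel ρ v) := fun φ ψ => by
  rw [C.form_swap ψ, C.form_gammaModel_swap φ ψ, ← mul_assoc, Int.cast_mul]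

theorem proj_swap_degreeSign (φ ψ : S₀) (v : Fin k → V) :
    C.proj k ψ φ v =
      ((C.sign 1 * degreeSign (C.sign 0 * C.sign 1) k : ℤ) : 𝕜) * C.proj k φ ψ v := by
  have hsign : C.sign 1 * degreeSign (C.sign 0 * C.sign 1) k =
      C.sign 0 * ((C.sign 0 * C.sign 1) ^ k * (-1) ^ k.choose 2) := by
    rw [degreeSign, pow_succ]
    linear_combination C.sign 0 * (C.sign 0 * C.sign 1) ^ k * (-1) ^ k.choose 2 *
      Int.isUnit_mul_self (C.isUnit_sign 1)
  rw [proj, C.form_swap, hasAdjointSign_gammaAnti C.hasAdjointSign_gammaModel, hsign, proj]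
  push_cast
  ring

theorem proj_swap (φ ψ : S₀) (v : Fin k → V) :
    C.proj k ψ φ v = (C.sign k : 𝕜) * C.proj k φ ψ v :=
  proj_swap_of_isUnit ((C.isUnit_sign 1).mul <|
    isUnit_degreeSign ((C.isUnit_sign 0).mul (C.isUnit_sign 1)) k) C.proj_swap_degreeSign φ ψ v

theorem separatingRight : C.form.SeparatingRight := fun ψ hψ =>
  C.nondegenerate ψ fun φ => by rw [C.form_swap φ ψ, hψ, mul_zero]

theorem sign_mul_sign_one {v : Fin k → V} (hv : gammaAnti (gammaModel ρ) v ≠ 0) :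
    C.sign k * C.sign 1 = degreeSign (C.sign 0 * C.sign 1) k := by
  obtain ⟨ψ, hψ⟩ := DFunLike.ne_iff.1 hv
  obtain ⟨φ, hφ⟩ : ∃ φ, C.proj k φ ψ v ≠ 0 := by
    by_contra! h
    exact hψ (C.separatingRight _ h)
  have h : C.sign k = C.sign 1 * degreeSign (C.sign 0 * C.sign 1) k := by
    exact_mod_cast mul_right_cancel₀ hφ
      ((C.proj_swap φ ψ v).symm.trans (C.proj_swap_degreeSign φ ψ v))
  rw [h, mul_right_comm, Int.isUnit_mul_self (C.isUnit_sign 1), one_mul]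

end ChargeConjugation

section SpinLieAlgebra

variable {𝕜 : Type*} [RCLike 𝕜] {V : Type*} [AddCommGroup V] [Module ℝ V] {η : QuadraticForm ℝ V}
  {S₀ : Type*} [AddCommGroup S₀] [Module ℝ S₀] [Module 𝕜 S₀] [IsScalarTower ℝ 𝕜 S₀]
  {ρ : CliffordAlgebra (-η) →ₐ[ℝ] Module.End 𝕜 S₀}

theorem ChargeConjugation.hasAdjointSign_spinLieAlgebra (C : ChargeConjugation ρ)
    {a : CliffordAlgebra (-η)} (ha : a ∈ spinLieAlgebra (-η)) :
    HasAdjointSign C.form (-1) (ρ a) := by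
  induction ha using Submodule.span_induction with
  | mem a ha =>
    obtain ⟨v, w, rfl⟩ := ha
    have hsq : ((C.sign 0 * C.sign 1 : ℤ) : 𝕜) * (C.sign 0 * C.sign 1 : ℤ) = 1 := by
      exact_mod_cast Int.isUnit_mul_self ((C.isUnit_sign 0).mul (C.isUnit_sign 1))
    have h := (C.hasAdjointSign_gammaModel v).commutator (C.hasAdjointSign_gammaModel w)
    rw [hsq] at h
    rwa [map_sub, map_mul, map_mul]
  | zero => simp [HasAdjointSign]
  | add a b _ _ ha hb =>
    intro φ ψ
    rw [map_add, LinearMap.add_apply, map_add, LinearMap.add_apply, ha, hb, LinearMap.add_apply,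
      map_add, mul_add]
  | smul r a _ ha =>
    rw [map_smul, ← algebraMap_smul 𝕜]
    exact ha.smul _

end SpinLieAlgebra

section Twist

variable {𝕜 : Type*} [RCLike 𝕜] {W : Type*} [AddCommGroup W] [Module 𝕜 W]

theorem twist_apply (m : Matrix (Fin 2) (Fin 2) ℤ) (ξ : W × W) :
    twist (𝕜 := 𝕜) m ξ =
      ((m 0 0 : 𝕜) • ξ.1 + (m 0 1 : 𝕜) • ξ.2, (m 1 0 : 𝕜) • ξ.1 + (m 1 1 : 𝕜) • ξ.2) := by
  simp [twist, Int.cast_smul_eq_zsmul]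

theorem twist_one : twist (1 : Matrix (Fin 2) (Fin 2) ℤ) = (1 : Module.End 𝕜 (W × W)) := by
  refine LinearMap.ext fun ξ => ?_
  simp [twist_apply]

theorem twist_mul (m p : Matrix (Fin 2) (Fin 2) ℤ) :
    twist (m * p) = (twist m * twist p : Module.End 𝕜 (W × W)) := by
  refine LinearMap.ext fun ξ => ?_
  rw [Module.End.mul_apply]
  simp only [twist_apply, Matrix.mul_apply, Fin.sum_univ_two]
  ext <;> push_cast <;> module

theorem isUnit_twist_tau (j : Fin 4) : IsUnit (twist (tau j) : Module.End 𝕜 (W × W)) := by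
  have left_inv : (tau j).transpose * tau j = 1 := by revert j; decide
  have right_inv : tau j * (tau j).transpose = 1 := by revert j; decide
  exact isUnit_iff_exists.2 ⟨twist (tau j).transpose,
    by rw [← twist_mul, right_inv, twist_one], by rw [← twist_mul, left_inv, twist_one]⟩

theorem prodMap_commute_twist (Φ : Module.End 𝕜 W) (m : Matrix (Fin 2) (Fin 2) ℤ) :
    Commute (Φ.prodMap Φ) (twist m) := by
  refine LinearMap.ext fun ξ => ?_
  simp [twist_apply]

theorem tensorTwist_ne_zero {Φ : Module.End 𝕜 W} (hΦ : Φ ≠ 0) (j : Fin 4) :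
    tensorTwist Φ (tau j) ≠ 0 := by
  rw [tensorTwist, Ne, (isUnit_twist_tau j).mul_left_eq_zero]
  refine fun h => hΦ (LinearMap.ext fun φ => ?_)
  exact congrArg Prod.fst (LinearMap.congr_fun h (φ, 0))

variable {C : W →ₗ[𝕜] W →ₗ[𝕜] 𝕜}

theorem formTwist_apply (m : Matrix (Fin 2) (Fin 2) ℤ) (φ ψ : W × W) :
    formTwist C m φ ψ = C φ.1 (twist (𝕜 := 𝕜) m ψ).1 + C φ.2 (twist (𝕜 := 𝕜) m ψ).2 := rfl

theorem formTwist_twist_left (m p : Matrix (Fin 2) (Fin 2) ℤ) (φ ψ : W × W) :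
    formTwist C m (twist (𝕜 := 𝕜) p φ) ψ = formTwist C (p.transpose * m) φ ψ := by
  simp only [formTwist_apply, twist_mul, Module.End.mul_apply]
  generalize twist (𝕜 := 𝕜) m ψ = ψ'
  simp only [twist_apply, map_add, map_smul, LinearMap.add_apply, LinearMap.smul_apply,
    smul_eq_mul, Matrix.transpose_apply]
  ring

theorem formTwist_zsmul (r : ℤ) (m : Matrix (Fin 2) (Fin 2) ℤ) (φ ψ : W × W) :
    formTwist C (r • m) φ ψ = (r : 𝕜) * formTwist C m φ ψ := by
  simp only [formTwist_apply, twist_apply, map_add, map_smul, smul_eq_mul, Matrix.smul_apply,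
    Int.cast_mul]
  ring

theorem HasAdjointSign.prodMap {Φ : Module.End 𝕜 W} {c : 𝕜} (hΦ : HasAdjointSign C c Φ)
    (m : Matrix (Fin 2) (Fin 2) ℤ) : HasAdjointSign (formTwist C m) c (Φ.prodMap Φ) := fun φ ψ => by
  have hcomm := LinearMap.congr_fun (prodMap_commute_twist Φ m).eq ψ
  simp only [Module.End.mul_apply] at hcomm
  rw [formTwist_apply, formTwist_apply, ← hcomm, mul_add]
  exact congrArg₂ (· + ·) (hΦ _ _) (hΦ _ _)

theorem hasAdjointSign_twist_tau (i j : Fin 4) :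
    HasAdjointSign (formTwist C (tau i)) ((eps j * epsComm i j : ℤ) : 𝕜) (twist (tau j)) :=
  fun φ ψ => by
    have hτ : (tau j).transpose * tau i = (eps j * epsComm i j) • (tau i * tau j) := by
      revert i j; decide
    rw [formTwist_twist_left, hτ, formTwist_zsmul, formTwist_apply _ _ (twist (tau j) ψ),
      ← Module.End.mul_apply, ← twist_mul, ← formTwist_apply]

theorem HasAdjointSign.tensorTwist_tau {Φ : Module.End 𝕜 W} {c : 𝕜} (hΦ : HasAdjointSign C c Φ)
    (i j : Fin 4) : HasAdjointSign (formTwist C (tau i)) (c * (eps j * epsComm i j : ℤ))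
      (tensorTwist Φ (tau j)) :=
  (hΦ.prodMap _).mul_of_commute (hasAdjointSign_twist_tau i j) (prodMap_commute_twist Φ _)

theorem formTwist_separatingRight (hC : C.SeparatingRight) (i : Fin 4) :
    (formTwist C (tau i)).SeparatingRight := fun ψ hψ => by
  have hτψ : twist (𝕜 := 𝕜) (tau i) ψ = 0 := Prod.ext
    (hC _ fun φ => by simpa [formTwist_apply] using hψ (φ, 0))
    (hC _ fun φ => by simpa [formTwist_apply] using hψ (0, φ))
  obtain ⟨σ, hσ⟩ := (isUnit_twist_tau (𝕜 := 𝕜) (W := W) i).exists_left_inv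
  simpa [hτψ] using (LinearMap.congr_fun hσ ψ).symm

end Twist

section GammaDouble

variable {𝕜 : Type*} [RCLike 𝕜] {T : Type*} [AddCommGroup T] [Module ℝ T]
  {W : Type*} [AddCommGroup W] [Module ℝ W] [Module 𝕜 W] [IsScalarTower ℝ 𝕜 W]
  {γ : T →ₗ[ℝ] Module.End 𝕜 W}

theorem IsCliffordMap.gammaDouble {B : LinearMap.BilinForm ℝ T} (hγ : IsCliffordMap γ B) :
    IsCliffordMap (gammaDouble γ) B := fun v w => LinearMap.ext fun ξ =>
  Prod.ext (LinearMap.congr_fun (hγ v w) ξ.1) (LinearMap.congr_fun (hγ v w) ξ.2)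

theorem tensorTwist_mul_gamma (Φ : Module.End 𝕜 W) (m : Matrix (Fin 2) (Fin 2) ℤ) (v : T) :
    tensorTwist (Φ * γ v) m = tensorTwist Φ m * gammaDouble γ v := by
  have hcomm : Commute (gammaDouble γ v) (twist m) := prodMap_commute_twist (γ v) m
  rw [tensorTwist, tensorTwist, mul_assoc, ← hcomm.eq]
  rfl

end GammaDouble

section Fibres

variable {E : Type*} [NormedAddCommGroup E] [NormedSpace ℝ E]
  {H : Type*} [TopologicalSpace H] {I : ModelWithCorners ℝ E H}
  {M : Type*} [TopologicalSpace M] [ChartedSpace H M] [IsManifold I ∞ M]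
  {𝕜 : Type*} [RCLike 𝕜] {V : Type*} [AddCommGroup V] [Module ℝ V] {η : QuadraticForm ℝ V}
  {S₀ : Type*} [AddCommGroup S₀] [Module ℝ S₀] [Module 𝕜 S₀] [IsScalarTower ℝ 𝕜 S₀]
  {F : Type*} [NormedAddCommGroup F] [NormedSpace ℝ F]
  {g : PseudoRiemannianMetric I M} {ρ : CliffordAlgebra (-η) →ₐ[ℝ] Module.End 𝕜 S₀}
  {S : M → Type*} [TopologicalSpace (TotalSpace F S)]
  [∀ x, AddCommGroup (S x)] [∀ x, Module ℝ (S x)] [∀ x, Module 𝕜 (S x)]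
  [∀ x, TopologicalSpace (S x)] [FiberBundle F S] [VectorBundle ℝ F S]
  (P : SpinStructure g ρ F S) (C : ChargeConjugation ρ)

namespace SpinStructure

theorem form_spinFrame {p x : M} (hx : x ∈ P.domain p) (φ ψ : S₀) :
    P.form C x (P.spinFrame p x φ) (P.spinFrame p x ψ) = C.form φ ψ := by
  obtain ⟨h, hh, -, hspin⟩ := P.transition x p x ⟨P.mem_domain x, hx⟩
  simp [hspin, form, C.spin_invariant h hh]

theorem form_separatingRight (x : M) : (P.form C x).SeparatingRight := fun ψ hψ => by
  have h : (P.spinFrame x x).symm ψ = 0 := C.separatingRight _ fun φ => by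
    simpa [form] using hψ (P.spinFrame x x φ)
  simpa using h

theorem spinFrame_diffAt (x : M) (φ : S₀) : SectionDiffAt I F (fun y => P.spinFrame x y φ) x :=
  ((P.spinFrame_smooth x φ).contMDiffAt
    ((P.isOpen_domain x).mem_nhds (P.mem_domain x))).mdifferentiableAt (by simp)

theorem vecFrame_diffAt (x : M) (v : V) : SectionDiffAt I E (fun y => P.vecFrame x y v) x :=
  ((P.vecFrame_smooth x v).contMDiffAt
    ((P.isOpen_domain x).mem_nhds (P.mem_domain x))).mdifferentiableAt (by simp)

theorem finiteDimensional_vector (P : SpinStructure g ρ F S) [FiniteDimensional ℝ E] (x : M) :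
    FiniteDimensional ℝ V :=
  have : FiniteDimensional ℝ (TangentSpace I x) := inferInstanceAs (FiniteDimensional ℝ E)
  Module.Finite.equiv (P.vecFrame x x).symm

variable [∀ x, IsScalarTower ℝ 𝕜 (S x)]

theorem gamma_eq_conj (x : M) (X : TangentSpace I x) :
    P.gamma x X =
      (P.spinFrame x x).conjAlgEquiv ℝ (gammaModel ρ ((P.vecFrame x x).symm X)) := rfl

theorem gamma_spinFrame {p x : M} (hx : x ∈ P.domain p) (v : V) (φ : S₀) :
    P.gamma x (P.vecFrame p x v) (P.spinFrame p x φ) = P.spinFrame p x (gammaModel ρ v φ) := by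
  obtain ⟨h, hh, hvec, hspin⟩ := P.transition x p x ⟨P.mem_domain x, hx⟩
  simp only [hspin, gamma_eq_conj, LinearEquiv.conjAlgEquiv_apply, LinearEquiv.symm_apply_apply,
    gammaModel, LinearMap.comp_apply, AlgHom.toLinearMap_apply, LinearEquiv.coe_coe, hvec]
  rw [← Module.End.mul_apply, ← map_mul, mul_assoc, spinGroup.star_mul_self_of_mem hh, mul_one,
    map_mul, Module.End.mul_apply]

theorem isCliffordMap_gamma (x : M) : IsCliffordMap (P.gamma x) (g.bilin x) := fun X Y => by
  have isometry (X : TangentSpace I x) : η ((P.vecFrame x x).symm X) = g.bilin x X X := by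
    rw [← P.vecFrame_isometry x x (P.mem_domain x), LinearEquiv.apply_symm_apply]
    rfl
  have polarization : QuadraticMap.polar (-η) ((P.vecFrame x x).symm X)
      ((P.vecFrame x x).symm Y) = -2 * g.bilin x X Y := by
    have symmetric : g.bilin x Y X = g.bilin x X Y := g.symm x Y X
    simp only [QuadraticMap.polar, neg_apply, ← map_add, isometry]
    simp only [map_add, LinearMap.add_apply, symmetric]
    ring
  simp only [gamma_eq_conj, ← map_mul, ← map_add, gammaModel, LinearMap.comp_apply,
    AlgHom.toLinearMap_apply, CliffordAlgebra.ι_mul_ι_add_swap, polarization, AlgHom.commutes,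
    AlgEquiv.commutes]
  exact Algebra.algebraMap_eq_smul_one _

theorem hasAdjointSign_gamma (x : M) (X : TangentSpace I x) :
    HasAdjointSign (P.form C x) ((C.sign 0 * C.sign 1 : ℤ) : 𝕜) (P.gamma x X) := fun φ ψ => by
  simpa [form, gamma] using C.hasAdjointSign_gammaModel _ _ ((P.spinFrame x x).symm ψ)

theorem gammaAnti_gamma (x : M) {k : ℕ} (v : Fin k → TangentSpace I x) :
    gammaAnti (P.gamma x) v = (P.spinFrame x x).conjAlgEquiv 𝕜
      (gammaAnti (gammaModel ρ) ((P.vecFrame x x).symm ∘ v)) := by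
  simp only [gammaAnti, map_smul, map_sum, map_zsmul, map_list_prod, List.map_ofFn]
  rfl

theorem sign_mul_sign_one (P : SpinStructure g ρ F S)
    [FiniteDimensional ℝ E] [Nontrivial S₀] {ℓ : ℕ} {x : M}
    {α : TangentSpace I x [⋀^Fin ℓ]→ₗ[ℝ] 𝕜} (hα : α ≠ 0) :
    C.sign ℓ * C.sign 1 = degreeSign (C.sign 0 * C.sign 1) ℓ := by
  have : FiniteDimensional ℝ (TangentSpace I x) := inferInstanceAs (FiniteDimensional ℝ E)
  have : Nontrivial (S x) := (P.spinFrame x x).symm.toEquiv.nontrivial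
  obtain ⟨v, hv⟩ : ∃ v : Fin ℓ → TangentSpace I x, gammaAnti (P.gamma x) v ≠ 0 := by
    by_contra! h
    exact formEnd_ne_zero (P.isCliffordMap_gamma x) (g.bilin_nondegenerate x) hα
      (by simp [formEnd, h])
  exact C.sign_mul_sign_one fun h => hv (by rw [gammaAnti_gamma, h, map_zero])

theorem finiteDimensional_spinor (P : SpinStructure g ρ F S) [FiniteDimensional ℝ F] (x : M) :
    FiniteDimensional ℝ S₀ :=
  Module.Finite.equiv (((P.spinFrame x x).restrictScalars ℝ).trans
    ((trivializationAt F S x).linearEquivAt ℝ x (FiberBundle.mem_baseSet_trivializationAt' x))).symm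

end SpinStructure

end Fibres

/-! ### Local frames and parallel pairings -/

section Frames

variable {E : Type*} [NormedAddCommGroup E] [NormedSpace ℝ E]
  {H : Type*} [TopologicalSpace H] {I : ModelWithCorners ℝ E H}
  {M : Type*} [TopologicalSpace M] [ChartedSpace H M]
  {F : Type*} [NormedAddCommGroup F] [NormedSpace ℝ F]
  {ι : Type*} [Fintype ι] {x : M}

/-- The linear map `c ↦ ∑ i, c i • u i` with columns `u i`, as a continuous linear function
of `u`. -/
def columnMap (ι F : Type*) [Fintype ι] [NormedAddCommGroup F] [NormedSpace ℝ F] :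
    (ι → F) →L[ℝ] (ι → ℝ) →L[ℝ] F :=
  ∑ i, ContinuousLinearMap.smulRightL ℝ (ι → ℝ) F (ContinuousLinearMap.proj i) ∘L
    ContinuousLinearMap.proj i

theorem columnMap_apply (u : ι → F) (c : ι → ℝ) : columnMap ι F u c = ∑ i, c i • u i := by
  simp [columnMap]

theorem mdifferentiableAt_pi {u : ι → M → F} (hu : ∀ i, MDifferentiableAt I 𝓘(ℝ, F) (u i) x) :
    MDifferentiableAt I 𝓘(ℝ, ι → F) (fun y i => u i y) x :=
  (mdifferentiableAt_iff ..).2 ⟨continuousAt_pi.2 fun i => (hu i).continuousAt,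
    differentiableWithinAt_pi.2 fun i => ((mdifferentiableAt_iff ..).1 (hu i)).2⟩

theorem exists_eventually_eq_sum_smul {u : ι → M → F}
    (hu : ∀ i, MDifferentiableAt I 𝓘(ℝ, F) (u i) x) (b : Basis ι ℝ F) (hb : ∀ i, b i = u i x)
    {w : M → F} (hw : MDifferentiableAt I 𝓘(ℝ, F) w x) :
    ∃ c : ι → M → ℝ, (∀ i, MDifferentiableAt I 𝓘(ℝ, ℝ) (c i) x) ∧
      ∀ᶠ y in nhds x, w y = ∑ i, c i y • u i y := by
  let L (y : M) : (ι → ℝ) →L[ℝ] F := columnMap ι F fun i => u i y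
  have hL : MDifferentiableAt I 𝓘(ℝ, (ι → ℝ) →L[ℝ] F) L x :=
    (columnMap ι F).mdifferentiableAt.comp x (mdifferentiableAt_pi hu)
  let e : (ι → ℝ) ≃L[ℝ] F := b.equivFun.symm.toContinuousLinearEquiv
  have he : (e : (ι → ℝ) →L[ℝ] F) = L x := by
    ext1 c
    simp [e, L, columnMap_apply, Basis.equivFun_symm_apply, hb]
  have invertible : ∀ᶠ y in nhds x, (L y).IsInvertible :=
    hL.continuousAt.eventually (he ▸ ContinuousLinearEquiv.nhds e)
  have hinv : DifferentiableAt ℝ ContinuousLinearMap.inverse (L x) :=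
    he ▸ (contDiffAt_map_inverse (n := 1) e).differentiableAt one_ne_zero
  have hc := (hinv.mdifferentiableAt.comp x hL).clm_apply hw
  refine ⟨fun i y => (L y).inverse (w y) i, fun i =>
    (ContinuousLinearMap.proj (R := ℝ) (φ := fun _ : ι => ℝ) i).mdifferentiableAt.comp x hc, ?_⟩
  filter_upwards [invertible] with y hy
  rw [← columnMap_apply]
  exact (hy.self_apply_inverse _).symm

variable {W : M → Type*} [TopologicalSpace (TotalSpace F W)]
  [∀ x, AddCommGroup (W x)] [∀ x, Module ℝ (W x)] [∀ x, TopologicalSpace (W x)]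
  [FiberBundle F W] [VectorBundle ℝ F W]

theorem exists_frame_coeff {s : ι → Π y, W y}
    (hs : ∀ i, SectionDiffAt I F (s i) x) (b : Basis ι ℝ (W x)) (hb : ∀ i, b i = s i x)
    {σ : Π y, W y} (hσ : SectionDiffAt I F σ x) :
    ∃ c : ι → M → ℝ, (∀ i, MDifferentiableAt I 𝓘(ℝ, ℝ) (c i) x) ∧
      ∀ᶠ y in nhds x, σ y = ∑ i, c i y • s i y := by
  let t := trivializationAt F W x
  have hx : x ∈ t.baseSet := FiberBundle.mem_baseSet_trivializationAt' x
  obtain ⟨c, hc, h⟩ := exists_eventually_eq_sum_smul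
    (fun i => (mdifferentiableAt_section I (s i)).1 (hs i))
    (b.map (t.linearEquivAt ℝ x hx)) (fun i => by simp [hb, t])
    ((mdifferentiableAt_section I σ).1 hσ)
  refine ⟨c, hc, ?_⟩
  filter_upwards [h, t.open_baseSet.mem_nhds hx] with y hy hyt
  apply (t.linearEquivAt ℝ y hyt).injective
  simpa [map_sum, map_smul] using hy

end Frames

section ParallelPairings

variable {E : Type*} [NormedAddCommGroup E] [NormedSpace ℝ E]
  {H : Type*} [TopologicalSpace H] {I : ModelWithCorners ℝ E H}
  {M : Type*} [TopologicalSpace M] [ChartedSpace H M]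
  {F₁ : Type*} [NormedAddCommGroup F₁] [NormedSpace ℝ F₁]
  {W₁ : M → Type*} [TopologicalSpace (TotalSpace F₁ W₁)]
  [∀ x, AddCommGroup (W₁ x)] [∀ x, Module ℝ (W₁ x)] [∀ x, TopologicalSpace (W₁ x)]
  [∀ x, IsTopologicalAddGroup (W₁ x)] [∀ x, ContinuousSMul ℝ (W₁ x)]
  [FiberBundle F₁ W₁]
  {F₂ : Type*} [NormedAddCommGroup F₂] [NormedSpace ℝ F₂]
  {W₂ : M → Type*} [TopologicalSpace (TotalSpace F₂ W₂)]
  [∀ x, AddCommGroup (W₂ x)] [∀ x, Module ℝ (W₂ x)] [∀ x, TopologicalSpace (W₂ x)]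
  [∀ x, IsTopologicalAddGroup (W₂ x)] [∀ x, ContinuousSMul ℝ (W₂ x)]
  [FiberBundle F₂ W₂]
  {F₃ : Type*} [NormedAddCommGroup F₃] [NormedSpace ℝ F₃]
  {W₃ : M → Type*} [TopologicalSpace (TotalSpace F₃ W₃)]
  [∀ x, AddCommGroup (W₃ x)] [∀ x, Module ℝ (W₃ x)] [∀ x, TopologicalSpace (W₃ x)]
  [∀ x, IsTopologicalAddGroup (W₃ x)] [∀ x, ContinuousSMul ℝ (W₃ x)]
  [FiberBundle F₃ W₃]

/-- The product rule at `x` for the pairing of the sections `σ` and `τ` by `β`, together with the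
differentiability of `β(σ, τ)` at `x`, which keeps the derivative from being a junk value. -/
def LeibnizAt (β : Π x, W₁ x →ₗ[ℝ] W₂ x →ₗ[ℝ] W₃ x) (D₁ : CovariantDerivative I F₁ W₁)
    (D₂ : CovariantDerivative I F₂ W₂) (D₃ : CovariantDerivative I F₃ W₃)
    (σ : Π x, W₁ x) (τ : Π x, W₂ x) (x : M) : Prop :=
  SectionDiffAt I F₃ (fun y => β y (σ y) (τ y)) x ∧
    ∀ X, D₃ (fun y => β y (σ y) (τ y)) x X = β x (D₁ σ x X) (τ x) + β x (σ x) (D₂ τ x X)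

variable {β : Π x, W₁ x →ₗ[ℝ] W₂ x →ₗ[ℝ] W₃ x} {D₁ : CovariantDerivative I F₁ W₁}
  {D₂ : CovariantDerivative I F₂ W₂} {D₃ : CovariantDerivative I F₃ W₃} {x : M}

namespace LeibnizAt

theorem flip {σ : Π x, W₁ x} {τ : Π x, W₂ x} (h : LeibnizAt β D₁ D₂ D₃ σ τ x) :
    LeibnizAt (fun y => (β y).flip) D₂ D₁ D₃ τ σ x :=
  ⟨h.1, fun X => (h.2 X).trans (add_comm _ _)⟩

theorem congr_left {σ σ' : Π x, W₁ x} {τ : Π x, W₂ x} (hσ : SectionDiffAt I F₁ σ x)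
    (hσ' : SectionDiffAt I F₁ σ' x) (hσσ' : ∀ᶠ y in nhds x, σ y = σ' y)
    (h : LeibnizAt β D₁ D₂ D₃ σ τ x) : LeibnizAt β D₁ D₂ D₃ σ' τ x := by
  have pairing_eq : ∀ᶠ y in nhds x, β y (σ y) (τ y) = β y (σ' y) (τ y) :=
    hσσ'.mono fun y hy => by rw [hy]
  have differentiable : SectionDiffAt I F₃ (fun y => β y (σ' y) (τ y)) x :=
    h.1.congr_of_eventuallyEq (pairing_eq.mono fun y hy => by simp [hy])
  refine ⟨differentiable, fun X => ?_⟩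
  rw [← D₃.isCovariantDerivativeOnUniv.congr_of_eventuallyEq h.1 differentiable
    Filter.univ_mem pairing_eq, h.2,
    D₁.isCovariantDerivativeOnUniv.congr_of_eventuallyEq hσ hσ' Filter.univ_mem hσσ',
    hσσ'.self_of_nhds]

variable [VectorBundle ℝ F₃ W₃]

theorem add_left {σ σ' : Π x, W₁ x} {τ : Π x, W₂ x} (hσ : SectionDiffAt I F₁ σ x)
    (hσ' : SectionDiffAt I F₁ σ' x) (h : LeibnizAt β D₁ D₂ D₃ σ τ x)
    (h' : LeibnizAt β D₁ D₂ D₃ σ' τ x) : LeibnizAt β D₁ D₂ D₃ (σ + σ') τ x := by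
  have pairing_add : (fun y => β y ((σ + σ') y) (τ y)) =
      (fun y => β y (σ y) (τ y)) + fun y => β y (σ' y) (τ y) := by ext1; simp
  rw [LeibnizAt, pairing_add]
  refine ⟨mdifferentiableAt_add_section h.1 h'.1, fun X => ?_⟩
  rw [D₃.isCovariantDerivativeOnUniv.add h.1 h'.1, D₁.isCovariantDerivativeOnUniv.add hσ hσ']
  simp only [add_apply, h.2, h'.2, map_add, LinearMap.add_apply, Pi.add_apply]
  abel

theorem smul_left {c : M → ℝ} {σ : Π x, W₁ x} {τ : Π x, W₂ x}
    (hc : MDifferentiableAt I 𝓘(ℝ, ℝ) c x) (hσ : SectionDiffAt I F₁ σ x)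
    (h : LeibnizAt β D₁ D₂ D₃ σ τ x) : LeibnizAt β D₁ D₂ D₃ (c • σ) τ x := by
  have pairing_smul : (fun y => β y ((c • σ) y) (τ y)) = c • fun y => β y (σ y) (τ y) := by
    ext1; simp
  rw [LeibnizAt, pairing_smul]
  refine ⟨hc.smul_section h.1, fun X => ?_⟩
  rw [D₃.isCovariantDerivativeOnUniv.leibniz h.1 hc, D₁.isCovariantDerivativeOnUniv.leibniz hσ hc]
  simp [h.2]
  abel

variable [VectorBundle ℝ F₁ W₁]

theorem zero_left (τ : Π x, W₂ x) : LeibnizAt β D₁ D₂ D₃ 0 τ x := by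
  have pairing_zero : (fun y => β y ((0 : Π y, W₁ y) y) (τ y)) = 0 := by ext1; simp
  rw [LeibnizAt, pairing_zero]
  exact ⟨mdifferentiableAt_zeroSection .., fun X => by simp [D₁.zero, D₃.zero]⟩

theorem of_frame_left {U : Type*} [AddCommGroup U] [Module ℝ U] [FiniteDimensional ℝ U]
    {s : Π y, U ≃ₗ[ℝ] W₁ y} (hs : ∀ u, SectionDiffAt I F₁ (fun y => s y u) x)
    {τ : Π y, W₂ y} (h : ∀ u, LeibnizAt β D₁ D₂ D₃ (fun y => s y u) τ x)
    {σ : Π y, W₁ y} (hσ : SectionDiffAt I F₁ σ x) : LeibnizAt β D₁ D₂ D₃ σ τ x := by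
  let b := finBasis ℝ U
  obtain ⟨c, hc, hσc⟩ :=
    exists_frame_coeff (fun i => hs (b i)) (b.map (s x)) (fun _ => b.map_apply ..) hσ
  let term (i) : Π y, W₁ y := c i • fun y => s y (b i)
  obtain ⟨sum_diffAt, sum_leibniz⟩ : SectionDiffAt I F₁ (∑ i, term i) x ∧
      LeibnizAt β D₁ D₂ D₃ (∑ i, term i) τ x :=
    Finset.sum_induction term (fun σ => SectionDiffAt I F₁ σ x ∧ LeibnizAt β D₁ D₂ D₃ σ τ x)
      (fun _ _ h h' => ⟨mdifferentiableAt_add_section h.1 h'.1, add_left h.1 h'.1 h.2 h'.2⟩)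
      ⟨mdifferentiableAt_zeroSection .., zero_left τ⟩
      fun i _ => ⟨(hc i).smul_section (hs _), smul_left (hc i) (hs _) (h _)⟩
  exact congr_left sum_diffAt hσ (hσc.mono fun y hy => by simp [hy, term]) sum_leibniz

theorem of_frames [VectorBundle ℝ F₂ W₂]
    {U₁ : Type*} [AddCommGroup U₁] [Module ℝ U₁] [FiniteDimensional ℝ U₁]
    {U₂ : Type*} [AddCommGroup U₂] [Module ℝ U₂] [FiniteDimensional ℝ U₂]
    {s : Π y, U₁ ≃ₗ[ℝ] W₁ y} (hs : ∀ u, SectionDiffAt I F₁ (fun y => s y u) x)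
    {t : Π y, U₂ ≃ₗ[ℝ] W₂ y} (ht : ∀ u, SectionDiffAt I F₂ (fun y => t y u) x)
    (h : ∀ u u', LeibnizAt β D₁ D₂ D₃ (fun y => s y u) (fun y => t y u') x)
    {σ : Π y, W₁ y} {τ : Π y, W₂ y} (hσ : SectionDiffAt I F₁ σ x)
    (hτ : SectionDiffAt I F₂ τ x) : LeibnizAt β D₁ D₂ D₃ σ τ x :=
  of_frame_left hs (fun u => (of_frame_left ht (fun u' => (h u u').flip) hτ).flip) hσ

end LeibnizAt

end ParallelPairings

section TrivialConnection

variable {E : Type*} [NormedAddCommGroup E] [NormedSpace ℝ E]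
  {H : Type*} [TopologicalSpace H] (I : ModelWithCorners ℝ E H)
  (M : Type*) [TopologicalSpace M] [ChartedSpace H M]
  (G : Type*) [NormedAddCommGroup G] [NormedSpace ℝ G]

variable {I M G} in
theorem sectionDiffAt_trivial {f : M → G} {x : M} :
    SectionDiffAt (W := Trivial M G) I G f x ↔ MDifferentiableAt I 𝓘(ℝ, G) f x :=
  mdifferentiableAt_section I (E := Trivial M G) f

/-- The flat connection on the trivial bundle with fibre `G`: the derivative of functions. -/
def trivialConnection : CovariantDerivative I G (Trivial M G) where
  toFun f x := mvfderiv I (F := G) f x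
  isCovariantDerivativeOnUniv :=
    { add := fun hσ hσ' _ =>
        mvfderiv_add (sectionDiffAt_trivial.1 hσ) (sectionDiffAt_trivial.1 hσ')
      leibniz := fun hσ hg _ =>
        mvfderiv_smul hg (sectionDiffAt_trivial.1 hσ) }

end TrivialConnection

section SpinorParallel

variable {E : Type*} [NormedAddCommGroup E] [NormedSpace ℝ E]
  {H : Type*} [TopologicalSpace H] {I : ModelWithCorners ℝ E H}
  {M : Type*} [TopologicalSpace M] [ChartedSpace H M] [IsManifold I ∞ M]
  {𝕜 : Type*} [RCLike 𝕜] {V : Type*} [AddCommGroup V] [Module ℝ V] {η : QuadraticForm ℝ V}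
  {S₀ : Type*} [AddCommGroup S₀] [Module ℝ S₀] [Module 𝕜 S₀] [IsScalarTower ℝ 𝕜 S₀]
  {F : Type*} [NormedAddCommGroup F] [NormedSpace ℝ F]
  {g : PseudoRiemannianMetric I M} {ρ : CliffordAlgebra (-η) →ₐ[ℝ] Module.End 𝕜 S₀}
  {S : M → Type*} [TopologicalSpace (TotalSpace F S)]
  [∀ x, AddCommGroup (S x)] [∀ x, Module ℝ (S x)] [∀ x, Module 𝕜 (S x)]
  [∀ x, IsScalarTower ℝ 𝕜 (S x)]
  [∀ x, TopologicalSpace (S x)] [∀ x, IsTopologicalAddGroup (S x)] [∀ x, ContinuousSMul ℝ (S x)]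
  [FiberBundle F S] [VectorBundle ℝ F S]
  (P : SpinStructure g ρ F S) (C : ChargeConjugation ρ)
  {nabla : CovariantDerivative I E (TangentSpace I : M → Type _)}
  {nablaS : CovariantDerivative I F S}

namespace SpinStructure

/-- The charge conjugation as a real pairing with values in the trivial bundle. -/
def realForm (x : M) : S x →ₗ[ℝ] S x →ₗ[ℝ] Trivial M 𝕜 x :=
  (P.form C x).restrictScalars₁₂ ℝ ℝ

/-- Clifford multiplication as a pairing of a tangent vector with a spinor. -/
def gammaPairing (x : M) : TangentSpace I x →ₗ[ℝ] S x →ₗ[ℝ] S x :=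
  LinearMap.restrictScalarsₗ ℝ 𝕜 (S x) (S x) ℝ ∘ₗ P.gamma x

theorem leibnizAt_realForm_spinFrame (h : P.IsInducedConnection nabla nablaS) (x : M)
    (φ ψ : S₀) :
    LeibnizAt (P.realForm C) nablaS nablaS (trivialConnection I M 𝕜)
      (fun y => P.spinFrame x y φ) (fun y => P.spinFrame x y ψ) x := by
  have locally_const : (fun y => P.form C y (P.spinFrame x y φ) (P.spinFrame x y ψ))
      =ᶠ[nhds x] fun _ => C.form φ ψ :=
    Filter.eventually_of_mem ((P.isOpen_domain x).mem_nhds (P.mem_domain x))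
      fun y hy => P.form_spinFrame C hy φ ψ
  refine ⟨sectionDiffAt_trivial.2
    (mdifferentiableAt_const.congr_of_eventuallyEq locally_const), fun X => ?_⟩
  obtain ⟨a, ha, -, hS⟩ := h x x (P.mem_domain x) X
  have derivative_zero : mvfderiv I
      (fun y => P.form C y (P.spinFrame x y φ) (P.spinFrame x y ψ)) x X = 0 := by
    rw [show mvfderiv I _ x = mvfderiv I (fun _ => C.form φ ψ) x from
      locally_const.mfderiv_eq (I' := 𝓘(ℝ, 𝕜)), mvfderiv_const]
    rfl
  refine derivative_zero.trans ?_
  simp only [realForm, LinearMap.restrictScalars₁₂_apply_apply, hS]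
  rw [P.form_spinFrame C (P.mem_domain x), P.form_spinFrame C (P.mem_domain x),
    C.hasAdjointSign_spinLieAlgebra ha]
  simp

theorem leibnizAt_gammaPairing_frame (h : P.IsInducedConnection nabla nablaS) (x : M) (v : V)
    (φ : S₀) :
    LeibnizAt P.gammaPairing nabla nablaS nablaS
      (fun y => P.vecFrame x y v) (fun y => P.spinFrame x y φ) x := by
  have clifford_frame : ∀ᶠ y in nhds x, P.spinFrame x y (gammaModel ρ v φ) =
      P.gamma y (P.vecFrame x y v) (P.spinFrame x y φ) :=
    Filter.eventually_of_mem ((P.isOpen_domain x).mem_nhds (P.mem_domain x))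
      fun y hy => (P.gamma_spinFrame hy v φ).symm
  have frame_diffAt := P.spinFrame_diffAt x (gammaModel ρ v φ)
  have clifford_diffAt :
      SectionDiffAt I F (fun y => P.gamma y (P.vecFrame x y v) (P.spinFrame x y φ)) x :=
    frame_diffAt.congr_of_eventuallyEq (clifford_frame.mono fun y hy => by simp [hy])
  refine ⟨clifford_diffAt, fun X => ?_⟩
  obtain ⟨a, -, hV, hS⟩ := h x x (P.mem_domain x) X
  change nablaS (fun y => P.gamma y (P.vecFrame x y v) (P.spinFrame x y φ)) x X =
    P.gamma x (nabla (fun y => P.vecFrame x y v) x X) (P.spinFrame x x φ) +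
      P.gamma x (P.vecFrame x x v) (nablaS (fun y => P.spinFrame x y φ) x X)
  rw [← nablaS.isCovariantDerivativeOnUniv.congr_of_eventuallyEq frame_diffAt clifford_diffAt
    Filter.univ_mem clifford_frame, hS, hS, P.gamma_spinFrame (P.mem_domain x),
    ← (P.vecFrame x x).apply_symm_apply (nabla _ x X), P.gamma_spinFrame (P.mem_domain x),
    ← map_add]
  have lie_action := congrArg (fun b => ρ b φ) (hV v)
  simp only [map_sub, map_mul, LinearMap.sub_apply, Module.End.mul_apply] at lie_action
  simp only [gammaModel, LinearMap.comp_apply, AlgHom.toLinearMap_apply, ← lie_action,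
    sub_add_cancel]

theorem leibnizAt_realForm [FiniteDimensional ℝ F] (h : P.IsInducedConnection nabla nablaS)
    {x : M} {σ τ : Π y, S y} (hσ : SectionDiffAt I F σ x) (hτ : SectionDiffAt I F τ x) :
    LeibnizAt (P.realForm C) nablaS nablaS (trivialConnection I M 𝕜) σ τ x :=
  have := P.finiteDimensional_spinor x
  .of_frames (s := fun y => (P.spinFrame x y).restrictScalars ℝ)
    (t := fun y => (P.spinFrame x y).restrictScalars ℝ)
    (P.spinFrame_diffAt x) (P.spinFrame_diffAt x) (P.leibnizAt_realForm_spinFrame C h x) hσ hτ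

theorem leibnizAt_gammaPairing [FiniteDimensional ℝ E] [FiniteDimensional ℝ F]
    (h : P.IsInducedConnection nabla nablaS) {x : M} {Y : Π y : M, TangentSpace I y}
    {ξ : Π y, S y} (hY : SectionDiffAt I E Y x) (hξ : SectionDiffAt I F ξ x) :
    LeibnizAt P.gammaPairing nabla nablaS nablaS Y ξ x :=
  have := P.finiteDimensional_spinor x
  have := P.finiteDimensional_vector x
  .of_frames (s := P.vecFrame x) (t := fun y => (P.spinFrame x y).restrictScalars ℝ)
    (P.vecFrame_diffAt x) (P.spinFrame_diffAt x) (P.leibnizAt_gammaPairing_frame h x) hY hξ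

end SpinStructure

end SpinorParallel

/-! ### The induced connection on `S ⊕ S` -/

section DirectSum

variable {E : Type*} [NormedAddCommGroup E] [NormedSpace ℝ E]
  {H : Type*} [TopologicalSpace H] {I : ModelWithCorners ℝ E H}
  {M : Type*} [TopologicalSpace M] [ChartedSpace H M]
  {F : Type*} [NormedAddCommGroup F] [NormedSpace ℝ F]
  {W : M → Type*} [TopologicalSpace (TotalSpace F W)]
  [∀ x, AddCommGroup (W x)] [∀ x, TopologicalSpace (W x)] [FiberBundle F W]

section Components

variable {F' : Type*} [NormedAddCommGroup F'] [NormedSpace ℝ F']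
  {W' : M → Type*} [TopologicalSpace (TotalSpace F' W')]
  [∀ x, AddCommGroup (W' x)] [∀ x, TopologicalSpace (W' x)] [FiberBundle F' W']

theorem SectionDiffAt.fst {x : M} {σ : Π y, (W ×ᵇ W') y} (hσ : SectionDiffAt I (F × F') σ x) :
    SectionDiffAt I F (fun y => (σ y).1) x := by
  rw [SectionDiffAt, mdifferentiableAt_section] at hσ ⊢
  exact (ContinuousLinearMap.fst ℝ F F').mdifferentiableAt.comp x hσ

theorem SectionDiffAt.snd {x : M} {σ : Π y, (W ×ᵇ W') y} (hσ : SectionDiffAt I (F × F') σ x) :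
    SectionDiffAt I F' (fun y => (σ y).2) x := by
  rw [SectionDiffAt, mdifferentiableAt_section] at hσ ⊢
  exact (ContinuousLinearMap.snd ℝ F F').mdifferentiableAt.comp x hσ

end Components

variable [∀ x, Module ℝ (W x)] [VectorBundle ℝ F W]
  [∀ x, IsTopologicalAddGroup (W x)] [∀ x, ContinuousSMul ℝ (W x)]

theorem covariantDerivative_smul_add_smul (D : CovariantDerivative I F W) (a b : ℝ)
    {σ τ : Π y, W y} {x : M} (hσ : SectionDiffAt I F σ x) (hτ : SectionDiffAt I F τ x) :
    SectionDiffAt I F (a • σ + b • τ) x ∧ D (a • σ + b • τ) x = a • D σ x + b • D τ x := by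
  have haσ : SectionDiffAt I F (a • σ) x :=
    (mdifferentiableAt_const (c := a)).smul_section hσ
  have hbτ : SectionDiffAt I F (b • τ) x :=
    (mdifferentiableAt_const (c := b)).smul_section hτ
  refine ⟨mdifferentiableAt_add_section haσ hbτ, ?_⟩
  have hD := D.isCovariantDerivativeOnUniv
  rw [hD.add haσ hbτ, hD.smul_const a hσ, hD.smul_const b hτ]

variable {𝕜 : Type*} [RCLike 𝕜] [∀ x, Module 𝕜 (W x)]

theorem directSum_twist (D : CovariantDerivative I F W) (m : Matrix (Fin 2) (Fin 2) ℤ)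
    {τ : Π y, (W ×ᵇ W) y} {x : M} (hτ : SectionDiffAt I (F × F) τ x) :
    SectionDiffAt I F (fun y => (twist (𝕜 := 𝕜) m (τ y)).1) x ∧
    SectionDiffAt I F (fun y => (twist (𝕜 := 𝕜) m (τ y)).2) x ∧
    ∀ X, directSum D D (fun y => twist (𝕜 := 𝕜) m (τ y)) x X =
      twist (𝕜 := 𝕜) m (directSum D D τ x X) := by
  have twist_eq (y : M) (ξ : W y × W y) : twist (𝕜 := 𝕜) m ξ =
      ((m 0 0 : ℝ) • ξ.1 + (m 0 1 : ℝ) • ξ.2, (m 1 0 : ℝ) • ξ.1 + (m 1 1 : ℝ) • ξ.2) := by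
    simp only [twist_apply, Int.cast_smul_eq_zsmul]
  have row (k : Fin 2) := covariantDerivative_smul_add_smul D (m k 0) (m k 1) hτ.fst hτ.snd
  simp only [twist_eq]
  exact ⟨(row 0).1, (row 1).1, fun X => Prod.ext
    (congrArg (fun L => L X) (row 0).2) (congrArg (fun L => L X) (row 1).2)⟩

end DirectSum

section DirectSumAdmissible

variable {E : Type*} [NormedAddCommGroup E] [NormedSpace ℝ E]
  {H : Type*} [TopologicalSpace H] {I : ModelWithCorners ℝ E H}
  {M : Type*} [TopologicalSpace M] [ChartedSpace H M] [IsManifold I ∞ M]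
  {𝕜 : Type*} [RCLike 𝕜] {V : Type*} [AddCommGroup V] [Module ℝ V] {η : QuadraticForm ℝ V}
  {S₀ : Type*} [AddCommGroup S₀] [Module ℝ S₀] [Module 𝕜 S₀] [IsScalarTower ℝ 𝕜 S₀]
  {F : Type*} [NormedAddCommGroup F] [NormedSpace ℝ F] [FiniteDimensional ℝ F]
  {g : PseudoRiemannianMetric I M} {ρ : CliffordAlgebra (-η) →ₐ[ℝ] Module.End 𝕜 S₀}
  {S : M → Type*} [TopologicalSpace (TotalSpace F S)]
  [∀ x, AddCommGroup (S x)] [∀ x, Module ℝ (S x)] [∀ x, Module 𝕜 (S x)]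
  [∀ x, IsScalarTower ℝ 𝕜 (S x)]
  [∀ x, TopologicalSpace (S x)] [∀ x, IsTopologicalAddGroup (S x)] [∀ x, ContinuousSMul ℝ (S x)]
  [FiberBundle F S] [VectorBundle ℝ F S]
  {P : SpinStructure g ρ F S}
  {nabla : CovariantDerivative I E (TangentSpace I : M → Type _)}
  {nablaS : CovariantDerivative I F S}

namespace SpinStructure.IsInducedConnection

theorem isChargeDual_directSum (h : P.IsInducedConnection nabla nablaS)
    (C : ChargeConjugation ρ) (m : Matrix (Fin 2) (Fin 2) ℤ) :
    IsChargeDual (fun x => formTwist (P.form C x) m) (directSum nablaS nablaS)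
      (directSum nablaS nablaS) := fun x σ τ X hσ hτ => by
  obtain ⟨hτ₁, hτ₂, twist_parallel⟩ := directSum_twist (𝕜 := 𝕜) nablaS m hτ
  obtain ⟨diff₁, leibniz₁⟩ := P.leibnizAt_realForm C h hσ.fst hτ₁
  obtain ⟨diff₂, leibniz₂⟩ := P.leibnizAt_realForm C h hσ.snd hτ₂
  have derivative_add := congrArg (fun L => L X)
    (mvfderiv_add (sectionDiffAt_trivial.1 diff₁) (sectionDiffAt_trivial.1 diff₂))
  refine (derivative_add.trans (congrArg₂ (· + ·) (leibniz₁ X) (leibniz₂ X))).trans ?_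
  simp only [formTwist_apply, ← twist_parallel]
  exact add_add_add_comm _ _ _ _

variable [FiniteDimensional ℝ E]

theorem hatD_directSum (h : P.IsInducedConnection nabla nablaS) (X : Π x : M, TangentSpace I x)
    {Y : Π x : M, TangentSpace I x} {ξ : Π x, (S ×ᵇ S) x} {x : M} (hY : SectionDiffAt I E Y x)
    (hξ : SectionDiffAt I (F × F) ξ x) :
    hatD nabla (fun x => gammaDouble (P.gamma x)) (directSum nablaS nablaS)
      (directSum nablaS nablaS) X Y ξ x = 0 := by
  have component_zero {ζ : Π x, S x} (hζ : SectionDiffAt I F ζ x) :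
      hatD nabla P.gamma nablaS nablaS X Y ζ x = 0 := by
    rw [hatD, sub_sub, sub_eq_zero]
    exact (P.leibnizAt_gammaPairing h hY hζ).2 (X x)
  exact Prod.ext (component_zero hξ.fst) (component_zero hξ.snd)

theorem twistedAdmissible_directSum (h : P.IsInducedConnection nabla nablaS)
    (C : ChargeConjugation ρ) (i : Fin 4) :
    TwistedAdmissible P C nabla i (directSum nablaS nablaS) :=
  ⟨directSum nablaS nablaS, h.isChargeDual_directSum C (tau i), fun _ X Y _ hX hY hξ => by
    rw [h.hatD_directSum X hY hξ, h.hatD_directSum Y hX hξ, neg_zero]⟩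

end SpinStructure.IsInducedConnection

end DirectSumAdmissible

/-! ### Adding a one-form to an admissible connection -/

section Admissibility

variable {E : Type*} [NormedAddCommGroup E] [NormedSpace ℝ E]
  {H : Type*} [TopologicalSpace H] {I : ModelWithCorners ℝ E H}
  {M : Type*} [TopologicalSpace M] [ChartedSpace H M]
  {F : Type*} [NormedAddCommGroup F] [NormedSpace ℝ F]
  {W : M → Type*} [TopologicalSpace (TotalSpace F W)]
  [∀ x, AddCommGroup (W x)] [∀ x, Module ℝ (W x)]
  [∀ x, TopologicalSpace (W x)] [∀ x, IsTopologicalAddGroup (W x)] [∀ x, ContinuousSMul ℝ (W x)]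
  [FiberBundle F W]
  {𝕜 : Type*} [RCLike 𝕜] [∀ x, Module 𝕜 (W x)]
  {B : Π x : M, W x →ₗ[𝕜] W x →ₗ[𝕜] 𝕜} {D DC DC' : CovariantDerivative I F W}
  {A A' : Π x : M, TangentSpace I x →ₗ[ℝ] W x →ₗ[ℝ] W x}

theorem IsChargeDual.unique (hB : ∀ x, (B x).SeparatingRight) (h : IsChargeDual B D DC)
    (h' : IsChargeDual B D DC') {x : M} {τ : Π x, W x} (hτ : SectionDiffAt I F τ x)
    (X : TangentSpace I x) : DC' τ x X = DC τ x X := by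
  refine sub_eq_zero.1 (hB x _ fun φ => ?_)
  have hσ : SectionDiffAt I F (FiberBundle.extend F φ) x := FiberBundle.mdifferentiableAt_extend ..
  have equal_pairings := (h x _ τ X hσ hτ).symm.trans (h' x _ τ X hσ hτ)
  rw [FiberBundle.extend_apply_self] at equal_pairings
  rw [map_sub]
  linear_combination -equal_pairings

variable [FiniteDimensional ℝ E]

theorem IsChargeDual.addOneForm (h : IsChargeDual B D DC)
    (hA : ∀ x X φ ψ, B x (A x X φ) ψ + B x φ (A' x X ψ) = 0) :
    IsChargeDual B (addOneForm D A) (addOneForm DC A') := fun x σ τ X hσ hτ => by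
  rw [h x σ τ X hσ hτ, addOneForm_apply, addOneForm_apply, map_add, map_add, LinearMap.add_apply]
  linear_combination -hA x X (σ x) (τ x)

variable [IsManifold I ∞ M] [∀ x, IsScalarTower ℝ 𝕜 (W x)]
  {nabla : CovariantDerivative I E (TangentSpace I : M → Type _)}
  {γ : Π x : M, TangentSpace I x →ₗ[ℝ] Module.End 𝕜 (W x)}

theorem hatD_addOneForm (X Y : Π x : M, TangentSpace I x) (ξ : Π x, W x) (x : M) :
    hatD nabla γ (addOneForm D A) (addOneForm DC A') X Y ξ x = hatD nabla γ D DC X Y ξ x +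
      (A x (X x) (γ x (Y x) (ξ x)) - γ x (Y x) (A' x (X x) (ξ x))) := by
  simp only [hatD, addOneForm_apply, map_add]
  abel

theorem Admissible.addOneForm_iff (hB : ∀ x, (B x).SeparatingRight)
    (hD : Admissible nabla γ B D)
    (hA : ∀ x X φ ψ, B x (A x X φ) ψ + B x φ (A' x X ψ) = 0) :
    Admissible nabla γ B (addOneForm D A) ↔
      ∀ x X Y ξ, (A x X (γ x Y ξ) - γ x Y (A' x X ξ)) +
        (A x Y (γ x X ξ) - γ x X (A' x Y ξ)) = 0 := by
  obtain ⟨DC, hDC, hskew⟩ := hD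
  have symmetrization {x : M} {X Y : Π x : M, TangentSpace I x} {ξ : Π x, W x}
      (hX : SectionDiffAt I E X x) (hY : SectionDiffAt I E Y x) (hξ : SectionDiffAt I F ξ x) :
      hatD nabla γ (addOneForm D A) (addOneForm DC A') X Y ξ x +
        hatD nabla γ (addOneForm D A) (addOneForm DC A') Y X ξ x =
      (A x (X x) (γ x (Y x) (ξ x)) - γ x (Y x) (A' x (X x) (ξ x))) +
        (A x (Y x) (γ x (X x) (ξ x)) - γ x (X x) (A' x (Y x) (ξ x))) := by
    rw [hatD_addOneForm, hatD_addOneForm, hskew x X Y ξ hX hY hξ]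
    abel
  refine ⟨?_, fun h => ⟨_, hDC.addOneForm hA, fun x X Y ξ hX hY hξ =>
    eq_neg_of_add_eq_zero_left ((symmetrization hX hY hξ).trans (h x _ _ _))⟩⟩
  rintro ⟨DC', hDC', hskew'⟩ x X Y ξ
  have hX : SectionDiffAt I E (FiberBundle.extend E X) x := FiberBundle.mdifferentiableAt_extend ..
  have hY : SectionDiffAt I E (FiberBundle.extend E Y) x := FiberBundle.mdifferentiableAt_extend ..
  have hξ : SectionDiffAt I F (FiberBundle.extend F ξ) x := FiberBundle.mdifferentiableAt_extend ..
  have skew := hskew' x _ _ _ hX hY hξ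
  simp only [hatD, (hDC.addOneForm hA).unique hB hDC' hξ] at skew
  simpa only [FiberBundle.extend_apply_self] using
    (symmetrization hX hY hξ).symm.trans (eq_neg_iff_add_eq_zero.1 skew)

/-- The adjoint of `A X = Θ γ(X)` is `u t γ(X) Θ`, so by the Clifford relation the symmetrized
expression of `Admissible.addOneForm_iff` is `-2 b(X, Y) (1 + u t) Θ`. -/
theorem Admissible.addOneForm_mul_gamma_iff (hB : ∀ x, (B x).SeparatingRight)
    (hD : Admissible nabla γ B D) {b : Π x : M, LinearMap.BilinForm ℝ (TangentSpace I x)}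
    (hγ : ∀ x, IsCliffordMap (γ x) (b x)) {t u : 𝕜}
    (hγadj : ∀ x X, HasAdjointSign (B x) t (γ x X))
    {Θ : Π x, Module.End 𝕜 (W x)} (hΘadj : ∀ x, HasAdjointSign (B x) u (Θ x))
    (hA : ∀ x X ξ, A x X ξ = Θ x (γ x X ξ)) (hne : ∃ x, b x ≠ 0 ∧ Θ x ≠ 0) :
    Admissible nabla γ B (addOneForm D A) ↔ u * t = -1 := by
  let A' (x : M) : TangentSpace I x →ₗ[ℝ] W x →ₗ[ℝ] W x :=
    LinearMap.restrictScalarsₗ ℝ 𝕜 (W x) (W x) ℝ ∘ₗ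
      LinearMap.mulRight ℝ (-(u * t) • Θ x) ∘ₗ γ x
  have hA' (x X ξ) : A' x X ξ = -(u * t) • γ x X (Θ x ξ) := by simp [A']
  have adjoint (x X φ ψ) : B x (A x X φ) ψ + B x φ (A' x X ψ) = 0 := by
    have h := (hΘadj x).mul_apply (hγadj x X) φ ψ
    simp only [Module.End.mul_apply] at h
    rw [hA, hA', h, map_smul, smul_eq_mul]
    ring
  have symmetrization (x X Y ξ) : (A x X (γ x Y ξ) - γ x Y (A' x X ξ)) +
      (A x Y (γ x X ξ) - γ x X (A' x Y ξ)) = (-2 * b x X Y) • (1 + u * t) • Θ x ξ := by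
    have clifford (ζ : W x) : γ x X (γ x Y ζ) + γ x Y (γ x X ζ) = (-2 * b x X Y) • ζ :=
      LinearMap.congr_fun (hγ x X Y) ζ
    have left : Θ x (γ x X (γ x Y ξ)) + Θ x (γ x Y (γ x X ξ)) = (-2 * b x X Y) • Θ x ξ := by
      rw [← map_add, clifford, LinearMap.map_smul_of_tower]
    rw [hA, hA, hA', hA', map_smul, map_smul, add_smul, one_smul, smul_add, ← left,
      smul_comm (_ : ℝ), ← clifford]
    module
  rw [hD.addOneForm_iff hB adjoint]
  simp only [symmetrization]
  refine ⟨fun h => ?_, fun h => by simp [h]⟩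
  obtain ⟨x, hb, hΘ⟩ := hne
  obtain ⟨X, Y, hXY⟩ : ∃ X Y, b x X Y ≠ 0 := by
    by_contra! h0
    exact hb (LinearMap.ext₂ h0)
  obtain ⟨ξ, hξ⟩ : ∃ ξ, Θ x ξ ≠ 0 := by
    by_contra! h0
    exact hΘ (LinearMap.ext h0)
  have coefficient : 1 + u * t = 0 := by simpa [hXY, hξ] using h x X Y ξ
  exact (neg_eq_of_add_eq_zero_right coefficient).symm

end Admissibility

theorem exists_alternatingMap_ne_zero {K T : Type*} [Field K] [AddCommGroup T] [Module K T]
    [FiniteDimensional K T] (A : Type*) [Ring A] [Algebra K A] [Nontrivial A] {ℓ : ℕ}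
    (hℓ : ℓ ≤ finrank K T) : ∃ F : T [⋀^Fin ℓ]→ₗ[K] A, F ≠ 0 := by
  let b := Module.finBasis K T
  let p : T →ₗ[K] (Fin ℓ → K) := LinearMap.pi fun i => b.coord (Fin.castLE hℓ i)
  let volumeForm : T [⋀^Fin ℓ]→ₗ[K] K := Matrix.detRowAlternating.compLinearMap p
  have volumeForm_basis : volumeForm (fun i => b (Fin.castLE hℓ i)) = 1 := by
    have identity : (fun i => p (b (Fin.castLE hℓ i))) = (1 : Matrix (Fin ℓ) (Fin ℓ) K) := by
      ext i k
      simp [p, Finsupp.single_apply, Matrix.one_apply]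
    exact (congrArg Matrix.det identity).trans Matrix.det_one
  refine ⟨(Algebra.linearMap K A).compAlternatingMap volumeForm, fun h => ?_⟩
  simpa [volumeForm_basis] using congrArg (fun F => F fun i => b (Fin.castLE hℓ i)) h

section Contribution

variable {E : Type*} [NormedAddCommGroup E] [NormedSpace ℝ E]
  {H : Type*} [TopologicalSpace H] {I : ModelWithCorners ℝ E H}
  {M : Type*} [TopologicalSpace M] [ChartedSpace H M] [IsManifold I ∞ M]
  {𝕜 : Type*} [RCLike 𝕜] {V : Type*} [AddCommGroup V] [Module ℝ V] {η : QuadraticForm ℝ V}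
  {S₀ : Type*} [AddCommGroup S₀] [Module ℝ S₀] [Module 𝕜 S₀] [IsScalarTower ℝ 𝕜 S₀]
  {F : Type*} [NormedAddCommGroup F] [NormedSpace ℝ F]
  {g : PseudoRiemannianMetric I M} {ρ : CliffordAlgebra (-η) →ₐ[ℝ] Module.End 𝕜 S₀}
  {S : M → Type*} [TopologicalSpace (TotalSpace F S)]
  [∀ x, AddCommGroup (S x)] [∀ x, Module ℝ (S x)] [∀ x, Module 𝕜 (S x)]
  [∀ x, IsScalarTower ℝ 𝕜 (S x)] [∀ x, TopologicalSpace (S x)]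
  [FiberBundle F S] [VectorBundle ℝ F S]

theorem PseudoRiemannianMetric.bilin_ne_zero [Nontrivial E] (g : PseudoRiemannianMetric I M)
    (x : M) : g.bilin x ≠ 0 := fun h => by
  have : Nontrivial (TangentSpace I x) := inferInstanceAs (Nontrivial E)
  obtain ⟨X, hX⟩ := exists_ne (0 : TangentSpace I x)
  exact hX (g.nondegenerate x X fun Y => LinearMap.congr_fun₂ h X Y)

variable [FiniteDimensional ℝ E]

namespace SpinStructure

/-- The left factor `(1/ℓ!) F_{i₁ ⋯ i_ℓ} γ^{i₁ ⋯ i_ℓ} ⊗ τ_j` of `contribution P α j`, where `F` is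
the value of the form `α` at `x`. -/
def twistedForm (P : SpinStructure g ρ F S) {ℓ : ℕ}
    (α : Π x : M, TangentSpace I x [⋀^Fin ℓ]→ₗ[ℝ] 𝕜) (j : Fin 4) (x : M) :
    Module.End 𝕜 (S x × S x) :=
  haveI : FiniteDimensional ℝ (TangentSpace I x) := inferInstanceAs (FiniteDimensional ℝ E)
  tensorTwist (formEnd (P.gamma x) (g.bilin x) (g.bilin_nondegenerate x) (α x)) (tau j)

variable (P : SpinStructure g ρ F S) (C : ChargeConjugation ρ) {ℓ : ℕ}
  {α : Π x : M, TangentSpace I x [⋀^Fin ℓ]→ₗ[ℝ] 𝕜}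

theorem contribution_apply (j : Fin 4) (x : M) (X : TangentSpace I x) (ξ : (S ×ᵇ S) x) :
    contribution P α j x X ξ = P.twistedForm α j x (gammaDouble (P.gamma x) X ξ) :=
  LinearMap.congr_fun (tensorTwist_mul_gamma _ _ X) ξ

theorem hasAdjointSign_twistedForm (i j : Fin 4) (x : M) :
    HasAdjointSign (formTwist (P.form C x) (tau i))
      (((C.sign 0 * C.sign 1 : ℤ) : 𝕜) ^ ℓ * (-1) ^ ℓ.choose 2 * (eps j * epsComm i j : ℤ))
      (P.twistedForm α j x) :=
  haveI : FiniteDimensional ℝ (TangentSpace I x) := inferInstanceAs (FiniteDimensional ℝ E)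
  (hasAdjointSign_formEnd (P.hasAdjointSign_gamma C x) _ (α x)).tensorTwist_tau i j

theorem twistedForm_ne_zero [Nontrivial S₀] {x : M} (hα : α x ≠ 0) (j : Fin 4) :
    P.twistedForm α j x ≠ 0 := by
  have : FiniteDimensional ℝ (TangentSpace I x) := inferInstanceAs (FiniteDimensional ℝ E)
  have : Nontrivial (S x) := (P.spinFrame x x).symm.toEquiv.nontrivial
  exact tensorTwist_ne_zero
    (formEnd_ne_zero (P.isCliffordMap_gamma x) (g.bilin_nondegenerate x) hα) j

end SpinStructure

variable [∀ x, IsTopologicalAddGroup (S x)] [∀ x, ContinuousSMul ℝ (S x)]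
  {P : SpinStructure g ρ F S} {C : ChargeConjugation ρ}
  {nabla : CovariantDerivative I E (TangentSpace I : M → Type _)} {i : Fin 4}
  {D : CovariantDerivative I (F × F) (S ×ᵇ S)}

theorem TwistedAdmissible.addOneForm_contribution_iff [Nontrivial E] [Nontrivial S₀]
    (hD : TwistedAdmissible P C nabla i D) {ℓ : ℕ}
    {α : Π x : M, TangentSpace I x [⋀^Fin ℓ]→ₗ[ℝ] 𝕜} (hα : α ≠ 0) (j : Fin 4) :
    TwistedAdmissible P C nabla i (addOneForm D (contribution P α j)) ↔
      C.sign ℓ * C.sign 1 * eps j * epsComm i j = -1 := by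
  obtain ⟨x, hx⟩ := Function.ne_iff.1 hα
  refine (Admissible.addOneForm_mul_gamma_iff
    (fun x => formTwist_separatingRight (P.form_separatingRight C x) i) hD
    (fun x => (P.isCliffordMap_gamma x).gammaDouble)
    (fun x X => (P.hasAdjointSign_gamma C x X).prodMap (tau i))
    (P.hasAdjointSign_twistedForm C i j) (P.contribution_apply j)
    ⟨x, g.bilin_ne_zero x, P.twistedForm_ne_zero hx j⟩).trans ?_
  rw [mul_assoc, P.sign_mul_sign_one C hx, degreeSign, ← Int.cast_inj (α := 𝕜)]
  push_cast
  ring_nf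

end Contribution

end SpinorConnection

end

open SpinorConnection in
theorem theorem4p10_general
    {𝕜 : Type*} [RCLike 𝕜]
    {E : Type*} [NormedAddCommGroup E] [NormedSpace ℝ E] [FiniteDimensional ℝ E]
    (hdim : 0 < Module.finrank ℝ E)
    {H : Type*} [TopologicalSpace H] {I : ModelWithCorners ℝ E H}
    {M : Type*} [TopologicalSpace M] [ChartedSpace H M] [IsManifold I ∞ M] [Nonempty M]
    (g : PseudoRiemannianMetric I M)
    {V : Type*} [AddCommGroup V] [Module ℝ V] {η : QuadraticForm ℝ V}
    {S₀ : Type*} [AddCommGroup S₀] [Module ℝ S₀] [Module 𝕜 S₀] [IsScalarTower ℝ 𝕜 S₀]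
    [Nontrivial S₀]
    {ρ : CliffordAlgebra (-η) →ₐ[ℝ] Module.End 𝕜 S₀}
    {F : Type*} [NormedAddCommGroup F] [NormedSpace ℝ F] [FiniteDimensional ℝ F]
    {S : M → Type*} [TopologicalSpace (TotalSpace F S)]
    [∀ x, AddCommGroup (S x)] [∀ x, Module ℝ (S x)] [∀ x, Module 𝕜 (S x)]
    [∀ x, IsScalarTower ℝ 𝕜 (S x)]
    [∀ x, TopologicalSpace (S x)] [∀ x, IsTopologicalAddGroup (S x)]
    [∀ x, ContinuousSMul ℝ (S x)] [FiberBundle F S] [VectorBundle ℝ F S]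
    (P : SpinStructure g ρ F S) (C : ChargeConjugation ρ)
    (nabla : CovariantDerivative I E (TangentSpace I : M → Type _))
    (nablaS : CovariantDerivative I F S) (hnablaS : P.IsInducedConnection nabla nablaS) :
    (∀ (k : ℕ) (φ ψ : S₀) (v : Fin k → V),
      C.proj k ψ φ v = (C.sign k : 𝕜) * C.proj k φ ψ v) ∧
    (∀ (ℓ : ℕ) (α : Π x : M, TangentSpace I x [⋀^Fin ℓ]→ₗ[ℝ] 𝕜) (i j : Fin 4), α ≠ 0 →
      (TwistedAdmissible P C nabla i
          (addOneForm (directSum nablaS nablaS) (contribution P α j)) ↔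
        C.sign ℓ * C.sign 1 * eps j * epsComm i j = -1) ∧
      ∀ D : CovariantDerivative I (F × F) (S ×ᵇ S), TwistedAdmissible P C nabla i D →
        (TwistedAdmissible P C nabla i (addOneForm D (contribution P α j)) ↔
          C.sign ℓ * C.sign 1 * eps j * epsComm i j = -1)) ∧
    (∀ (ℓ : ℕ) (i j : Fin 4), ℓ ≤ Module.finrank ℝ E →
      (C.sign ℓ * C.sign 1 * eps j * epsComm i j = -1 ↔
        InTable (C.sign 0 * C.sign 1) ℓ i j)) := by
  have : Nontrivial E := nontrivial_of_finrank_pos hdim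
  refine ⟨fun _ => C.proj_swap, fun ℓ α i j hα =>
    ⟨(hnablaS.twistedAdmissible_directSum C i).addOneForm_contribution_iff hα j,
      fun D hD => hD.addOneForm_contribution_iff hα j⟩, fun ℓ i j hℓ => ?_⟩
  obtain ⟨x⟩ := ‹Nonempty M›
  obtain ⟨α, hα⟩ := exists_alternatingMap_ne_zero (T := E) 𝕜 hℓ
  rw [mul_assoc, P.sign_mul_sign_one C (x := x) hα]
  exact degreeSign_mul_eq_neg_one_iff ((C.isUnit_sign 0).mul (C.isUnit_sign 1)) ℓ i j

open SpinorConnection in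
theorem theorem4p10
    {𝕜 : Type*} [RCLike 𝕜]
    {E : Type*} [NormedAddCommGroup E] [NormedSpace ℝ E] [FiniteDimensional ℝ E]
    (hdim : 0 < Module.finrank ℝ E)
    {H : Type*} [TopologicalSpace H] {I : ModelWithCorners ℝ E H}
    {M : Type*} [TopologicalSpace M] [ChartedSpace H M] [IsManifold I ∞ M] [Nonempty M]
    (g : PseudoRiemannianMetric I M)
    {V : Type*} [AddCommGroup V] [Module ℝ V] {η : QuadraticForm ℝ V}
    {S₀ : Type*} [AddCommGroup S₀] [Module ℝ S₀] [Module 𝕜 S₀] [IsScalarTower ℝ 𝕜 S₀]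
    [Nontrivial S₀]
    {ρ : CliffordAlgebra (-η) →ₐ[ℝ] Module.End 𝕜 S₀}
    {F : Type*} [NormedAddCommGroup F] [NormedSpace ℝ F] [FiniteDimensional ℝ F]
    {S : M → Type*} [TopologicalSpace (TotalSpace F S)]
    [∀ x, AddCommGroup (S x)] [∀ x, Module ℝ (S x)] [∀ x, Module 𝕜 (S x)]
    [∀ x, IsScalarTower ℝ 𝕜 (S x)]
    [∀ x, TopologicalSpace (S x)] [∀ x, IsTopologicalAddGroup (S x)]
    [∀ x, ContinuousSMul ℝ (S x)] [FiberBundle F S] [VectorBundle ℝ F S]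
    [ContMDiffVectorBundle ∞ F S I]
    (P : SpinStructure g ρ F S) (C : ChargeConjugation ρ)
    (nabla : CovariantDerivative I E (TangentSpace I : M → Type _))
    (hnabla : IsLeviCivita g nabla)
    (nablaS : CovariantDerivative I F S) (hnablaS : P.IsInducedConnection nabla nablaS) :
    (∀ (k : ℕ) (φ ψ : S₀) (v : Fin k → V),
      C.proj k ψ φ v = (C.sign k : 𝕜) * C.proj k φ ψ v) ∧
    (∀ (ℓ : ℕ) (α : Π x : M, TangentSpace I x [⋀^Fin ℓ]→ₗ[ℝ] 𝕜) (i j : Fin 4), α ≠ 0 →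
      (TwistedAdmissible P C nabla i
          (addOneForm (directSum nablaS nablaS) (contribution P α j)) ↔
        C.sign ℓ * C.sign 1 * eps j * epsComm i j = -1) ∧
      ∀ D : CovariantDerivative I (F × F) (S ×ᵇ S), TwistedAdmissible P C nabla i D →
        (TwistedAdmissible P C nabla i (addOneForm D (contribution P α j)) ↔
          C.sign ℓ * C.sign 1 * eps j * epsComm i j = -1)) ∧
    (∀ (ℓ : ℕ) (i j : Fin 4), ℓ ≤ Module.finrank ℝ E →
      (C.sign ℓ * C.sign 1 * eps j * epsComm i j = -1 ↔
        InTable (C.sign 0 * C.sign 1) ℓ i j)) := by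
  exact theorem4p10_general hdim g P C nabla nablaS hnablaS
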